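/- **Setting.** Constants, labelled nulls and variables form three disjoint countably infinite sets. A *tuple-generating dependency* (TGD, rule) $\sigma$ is a formula $\Phi(\mathbf x,\mathbf y)\to\exists\mathbf z\,\Psi(\mathbf x,\mathbf z)$, where the body $\Phi$ and the head $\Psi$ are finite conjunctions of atoms over variables and constants; $\mathbf x$ are its frontier variables, $\mathbf z$ its existential variables. An *ontology* $\Sigma$ is a finite set of TGDs, renamed apart; a *class* of TGDs is an arbitrary set $\mathcal C$ of ontologies. An *instance* is a possibly infinite set of atoms over constants and nulls; a *database* is a finite set of atoms over constants. For a conjunctive query $q(\mathbf x)$, all of whose output variables occur in its atoms, $\mathrm{cert}(q,D,\Sigma)$ is the set of the constant tuples that are answers to $q$ in every instance $I\supseteq D$ that satisfies $\Sigma$. The problem *cert-eval*$[\mathcal C]$ has as inputs a database $D$, an ontology $\Sigma\in\mathcal C$, a conjunctive query $q(\mathbf x)$ and a constant tuple $\mathbf c$ of length $|\mathbf x|$, and asks whether $\mathbf c\in\mathrm{cert}(q,D,\Sigma)$. It is *decidable* if some algorithm halts with the correct answer on every such input (nothing is required when $\Sigma\notin\mathcal C$, so membership in $\mathcal C$ need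 not be decidable). It is *decidable as a set* if the set of its yes-instances $(D,\Sigma,q,\mathbf c)$ (with $\Sigma \in \mathcal C$) is a decidable set. **Affected positions.** Let $z$ be an existential variable of $\Sigma$. The $z$-affected positions are the least set of predicate positions that contains every position at which $z$ occurs in a head, and every position at which a frontier variable $x$ of a rule of $\Sigma$ occurs in the head, provided that $x$ occurs in the body of that rule at $z$-affected positions only. A variable of the body of $\sigma\in\Sigma$ is *harmful* if for some $z$ all its positions in the body are $z$-affected, and *harmless* otherwise; it is *dangerous* if it is harmful and a frontier variable. The set $p(\sigma)$ of the *problematic* atoms is the least set of body atoms of $\sigma$ that contains each body atom with a dangerous variable and each body atom that shares a harmful variable with an atom of $p(\sigma)$; $s(\sigma)$ is the set of the other body atoms. **The class Dyadic-$\mathcal C$.** Let $\mathrm{br}(\sigma)$ consist of the variables that occur both in $p(\sigma)$ and in $s(\sigma)$ and of the harmless frontier variables that occur in $s(\sigma)$. Let $\mathrm{main}(\sigma)$ be the rule $$\mathrm{Aux}_\sigma(\mathrm{br}(\sigma)),\ p(\sigma)\ \to\ \exists\,\mathbf z\ \mathrm{head}(\sigma)$$ with a predicate $\mathrm{Aux}_\sigma$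 that is new, one for each rule and chosen by a fixed computable convention. If a variable of $\mathrm{br}(\sigma)$ occurs $n>1$ times in $\mathrm{head}(\sigma)$, then its occurrences there receive $n$ different names (the first one being kept, the others new), all of which are arguments of $\mathrm{Aux}_\sigma$. Let $\mathrm{main}(\Sigma)=\{\mathrm{main}(\sigma):\sigma\in\Sigma\}$, and let Dyadic-$\mathcal C$ be the set of all ontologies $\Sigma$ with $\Sigma\in\mathcal C$ or $\mathrm{main}(\Sigma)\in\mathcal C$. **Theorem.** Let $\mathcal C$ be a class of TGDs. 1. Suppose that cert-eval$[\mathcal C]$ is decidable. Then cert-eval$[\{\Sigma:\mathrm{main}(\Sigma)\in\mathcal C\}]$ is decidable. Moreover, if there is an algorithm that, for each $\Sigma\in$ Dyadic-$\mathcal C$, finds one of the two conditions $\Sigma\in\mathcal C$ and $\mathrm{main}(\Sigma)\in\mathcal C$ that is true (for instance if membership in $\mathcal C$ is decidable, or if $\Sigma\in\mathcal C$ always implies $\mathrm{main}(\Sigma)\in\mathcal C$), then cert-eval$[$Dyadic-$\mathcal C]$ is decidable. 2. If cert-eval$[\mathcal C]$ is decidable as a set, then so is cert-eval$[$Dyadic-$\mathcal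 C]$. -/

import Mathlib

namespace DyadicTGD

/-! ### Syntax -/

/-- Terms of rules and queries: constants (`Sum.inl c`) and variables (`Sum.inr x`). -/
abbrev Term := ℕ ⊕ ℕ

abbrev Term.const (c : ℕ) : Term := Sum.inl c

abbrev Term.var (x : ℕ) : Term := Sum.inr x

/-- Values of instances: constants (`Sum.inl c`) and labelled nulls (`Sum.inr n`). -/
abbrev Value := ℕ ⊕ ℕ

abbrev Value.const (c : ℕ) : Value := Sum.inl c

abbrev Value.null (n : ℕ) : Value := Sum.inr n

/-- Atoms `P(t₁, …, tₖ)` with arguments in `α`: the name of `P` and the tuple of arguments.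
A predicate is a name together with an arity, so that atoms with equal names and a different
number of arguments belong to different predicates. -/
abbrev AtomOver (α : Type) := ℕ × List α

abbrev Atom := AtomOver Term

/-- A fact is an atom that contains only constants. -/
abbrev Fact := AtomOver ℕ

/-- A conjunction of atoms. -/
abbrev Conj := List Atom

/-- A tuple-generating dependency, as the pair (body, head). The existential variables are the
variables of the head that do not occur in the body. -/
abbrev Rule := Conj × Conj

/-- An ontology: a finite set of rules, given as a list. -/
abbrev Ontology := List Rule

/-- A database: a finite set of facts, given as a list. -/
abbrev Database := List Fact

/-- A conjunctive query, as the pair (tuple of output variables, conjunction of atoms); the other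
variables of the conjunction are existentially quantified. -/
abbrev CQ := List ℕ × Conj

/-- The variables of a tuple of terms. -/
def termVars (ts : List Term) : List ℕ := ts.filterMap Sum.getRight?

/-- The variables of a conjunction of atoms. -/
def conjVars (A : Conj) : List ℕ := A.flatMap fun a => termVars a.2

/-- Every output variable occurs in the conjunction. -/
def CQ.WellFormed (q : CQ) : Prop := ∀ x ∈ q.1, x ∈ conjVars q.2

/-! ### Semantics -/

/-- Instances: possibly infinite sets of atoms over constants and nulls. -/
abbrev Instance := Set (AtomOver Value)

/-- The image of a term under an assignment of the variables; constants are fixed. -/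
def valueOf (h : ℕ → Value) : Term → Value := Sum.elim Value.const h

/-- `h` is a homomorphism from the conjunction `A` to `I`. -/
def IsHom (h : ℕ → Value) (A : Conj) (I : Instance) : Prop :=
  ∀ a ∈ A, (a.1, a.2.map (valueOf h)) ∈ I

/-- The frontier variables: those that occur both in the body and in the head. -/
def IsFrontier (σ : Rule) (x : ℕ) : Prop := x ∈ conjVars σ.1 ∧ x ∈ conjVars σ.2

/-- The existential variables: those that occur in the head but not in the body. -/
def IsExVar (σ : Rule) (z : ℕ) : Prop := z ∈ conjVars σ.2 ∧ z ∉ conjVars σ.1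

def SatRule (I : Instance) (σ : Rule) : Prop :=
  ∀ h, IsHom h σ.1 I → ∃ h', (∀ x, IsFrontier σ x → h' x = h x) ∧ IsHom h' σ.2 I

/-- `I` is a model of the database `D` and the ontology `S`. -/
def IsModel (D : Database) (S : Ontology) (I : Instance) : Prop :=
  (∀ a ∈ D, (a.1, a.2.map Value.const) ∈ I) ∧ ∀ σ ∈ S, SatRule I σ

/-- The evaluation of a query over an instance: a set of tuples of constants. -/
def evalCQ (q : CQ) (I : Instance) : Set (List ℕ) :=
  {c | ∃ h, IsHom h q.2 I ∧ q.1.map h = c.map Value.const}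

/-- The certain answers. -/
def cert (q : CQ) (D : Database) (S : Ontology) : Set (List ℕ) :=
  {c | ∀ I, IsModel D S I → c ∈ evalCQ q I}

/-! ### Affected positions and classification of variables -/

/-- The position `P[i]` of the predicate with the given name and arity (`i` counted from `0`). -/
structure Position where
  name : ℕ
  arity : ℕ
  index : ℕ

/-- The variable `x` occurs in the conjunction `A` at position `π`. -/
def OccursAt (x : ℕ) (A : Conj) (π : Position) : Prop :=
  ∃ a ∈ A, a.1 = π.name ∧ a.2.length = π.arity ∧ a.2[π.index]? = some (Term.var x)

/-- `Affected S ρ z π`: the position `π` is `z`-affected, where `z` is an existential variable of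
the rule `ρ ∈ S`. Existential variables are identified by their rule and their name, so that
rules need not be renamed apart. -/
inductive Affected (S : Ontology) (ρ : Rule) (z : ℕ) : Position → Prop
  | intro {π : Position} (hρ : ρ ∈ S) (hz : IsExVar ρ z) (hπ : OccursAt z ρ.2 π) :
      Affected S ρ z π
  | propagate {π : Position} (σ : Rule) (x : ℕ) (hσ : σ ∈ S) (hx : IsFrontier σ x)
      (hπ : OccursAt x σ.2 π) (hb : ∀ π', OccursAt x σ.1 π' → Affected S ρ z π') :
      Affected S ρ z π

/-- The set of the existential variables that affect `π`. -/
def aff (S : Ontology) (π : Position) : Set (Rule × ℕ) := {e | Affected S e.1 e.2 π}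

/-- The existential variables that affect all the positions of the body of `σ` at which `x`
occurs. -/
def commonAff (S : Ontology) (σ : Rule) (x : ℕ) : Set (Rule × ℕ) :=
  {e | ∀ π, OccursAt x σ.1 π → e ∈ aff S π}

def Harmless (S : Ontology) (σ : Rule) (x : ℕ) : Prop :=
  x ∈ conjVars σ.1 ∧ commonAff S σ x = ∅

def Harmful (S : Ontology) (σ : Rule) (x : ℕ) : Prop :=
  x ∈ conjVars σ.1 ∧ commonAff S σ x ≠ ∅

def Dangerous (S : Ontology) (σ : Rule) (x : ℕ) : Prop :=
  Harmful S σ x ∧ IsFrontier σ x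

/-- The problematic atoms of the body of `σ`. -/
inductive Problematic (S : Ontology) (σ : Rule) : Atom → Prop
  | dangerous (a : Atom) (x : ℕ) (ha : a ∈ σ.1) (hx : x ∈ termVars a.2)
      (hd : Dangerous S σ x) : Problematic S σ a
  | connected (a b : Atom) (x : ℕ) (ha : a ∈ σ.1) (hb : Problematic S σ b)
      (hxa : x ∈ termVars a.2) (hxb : x ∈ termVars b.2) (hx : Harmful S σ x) :
      Problematic S σ a

/-! ### The main part of an ontology -/

open Classical in
noncomputable def pAtoms (S : Ontology) (σ : Rule) : Conj :=
  σ.1.filter fun a => Problematic S σ a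

open Classical in
noncomputable def sAtoms (S : Ontology) (σ : Rule) : Conj :=
  σ.1.filter fun a => ¬ Problematic S σ a

open Classical in
/-- The variables shared by problematic and safe atoms, and the harmless frontier variables of the
safe atoms; each of them is listed once. -/
noncomputable def bridge (S : Ontology) (σ : Rule) : List ℕ :=
  (conjVars (sAtoms S σ)).dedup.filter fun x =>
    x ∈ conjVars (pAtoms S σ) ∨ (Harmless S σ x ∧ IsFrontier σ x)

/-- A predicate name larger than all those of `S`. -/
def freshName (S : Ontology) : ℕ :=
  ((S.flatMap fun σ => (σ.1 ++ σ.2).map Prod.fst).foldr max 0) + 1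

/-- A variable larger than all those of `S`. -/
def freshVar (S : Ontology) : ℕ :=
  ((S.flatMap fun σ => conjVars (σ.1 ++ σ.2)).foldr max 0) + 1

/-- The head `H` with every argument `t` replaced by a pair `(t, t')`. If `t` is a variable of `B`
which occurs earlier in `H`, then `t'` is a new variable, a separate one for every such occurrence;
otherwise `t' = t`. -/
def splitHead (B : List ℕ) (new : ℕ → ℕ → ℕ) (H : Conj) : List (AtomOver (Term × Term)) :=
  H.mapIdx fun i a => (a.1, a.2.mapIdx fun j t =>
    match t with
    | Sum.inl c => (Term.const c, Term.const c)
    | Sum.inr x =>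
      if x ∈ B ∧ (x ∈ conjVars (H.take i) ∨ x ∈ termVars (a.2.take j))
      then (Term.var x, Term.var (new i j)) else (Term.var x, Term.var x))

/-- The rule `Aux_σ(bridge(σ)), p-atoms(σ) → ∃ exvars(σ) head(σ)` of the `k`-th rule `σ` of `S`,
with the fresh predicate `Aux_σ`. If a bridge variable occurs `n > 1` times in the head of `σ`, then
it is given `n` different names in the head, all of which are arguments of `Aux_σ`. -/
noncomputable def mainRule (S : Ontology) (k : ℕ) (σ : Rule) : Rule :=
  let B := bridge S σ
  let H := splitHead B (fun i j => freshVar S + Nat.pair k (Nat.pair i j)) σ.2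
  let copies := ((H.flatMap Prod.snd).filter fun p => p.1 ≠ p.2).map Prod.snd
  ((freshName S + k, B.map Term.var ++ copies) :: pAtoms S σ,
    H.map fun a => (a.1, a.2.map Prod.snd))

noncomputable def mainPart (S : Ontology) : Ontology := S.mapIdx (mainRule S)

/-- The class Dyadic-`C`. -/
def Dyadic (C : Set Ontology) : Set Ontology := {S | S ∈ C ∨ mainPart S ∈ C}

/-! ### The problem cert-eval -/

abbrev Input := Database × Ontology × CQ × List ℕ

/-- `(D, S, q, c)` is an input of cert-eval[`C`]. -/
def IsInput (C : Set Ontology) : Input → Prop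
  | (_, S, q, c) => S ∈ C ∧ q.WellFormed ∧ c.length = q.1.length

/-- The question of cert-eval: is `c` a certain answer? -/
def Holds : Input → Prop
  | (D, S, q, c) => c ∈ cert q D S

/-- cert-eval[`C`] is decidable: some algorithm halts with the correct answer on every input of the
problem. Nothing is required where the ontology is not in `C`, so that `C` itself need not be
recognizable. -/
def CertEvalDecidable (C : Set Ontology) : Prop :=
  ∃ f : Input →. Bool, Partrec f ∧
    ∀ w, IsInput C w → ∃ b ∈ f w, (b = true ↔ Holds w)

/-- The set of the yes-instances of cert-eval[`C`] is a decidable set; this algorithm also has to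
reject what is not an input of the problem. -/
def CertEvalDecidableSet (C : Set Ontology) : Prop :=
  ComputablePred fun w => IsInput C w ∧ Holds w

/-- Some algorithm finds, for every ontology in Dyadic-`C`, one of the two conditions `S ∈ C` and
`mainPart S ∈ C` that holds. -/
def CaseEffective (C : Set Ontology) : Prop :=
  ∃ s : Ontology →. Bool, Partrec s ∧
    ∀ S ∈ Dyadic C, ∃ b ∈ s S, (b = true → S ∈ C) ∧ (b = false → mainPart S ∈ C)

end DyadicTGD

namespace DyadicTGD

/-! ### Variables, values and names -/

/-! Suppose that `mainPart S ∈ C`. In the chase of the main part, a null occurs only at positions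
affected by the existential variable that created it (`chase_value`), while no single existential
variable affects all body positions of a harmless variable. Bridge variables are harmless
(`harmless_of_mem_bridge`), so they only take constants, from the finite list `domain D S`. Hence
finitely many facts over the predicates Aux are relevant. Each is found as a certain answer, over
the main part and the facts already found, to the query made of the safe atoms of its rule. Once
this process has stopped with a list `A`, the certain answers over `S` and `D` are those over
`mainPart S` and `D` with `A` (`cert_iff_cert_mainPart`).

Soundness: a model of `S`, extended by every Aux fact that its safe atoms justify, is a model of the
main part and contains `A`. Completeness: the chase of the main part without its Aux facts is a
model of `S` (`satRule_chaseReduct`), and the chase is universal (`exists_chase_hom`). Since `D` and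
the query may already use the names chosen for Aux, `shiftName` moves those names away.

Computability: affected positions and problematic atoms are least fixed points inside finite sets,
so a saturated derivation is a certificate for each that can be checked primitive recursively and
found by search. This makes `mainPart` computable. The algorithm for `C` is partial, so it is
replaced by a version with fuel, and one searches for a list `A` together with an amount of fuel
that confirms all the answers on which the saturation of `A` rests.

For decidability as a set, the trivial query reveals membership in `C`. This decides which case
applies and which inputs are to be rejected. -/

theorem mem_termVars {x : ℕ} {ts : List Term} : x ∈ termVars ts ↔ Term.var x ∈ ts := by
  simp [termVars, List.mem_filterMap, Sum.getRight?_eq_some_iff]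

theorem mem_conjVars {x : ℕ} {A : Conj} : x ∈ conjVars A ↔ ∃ a ∈ A, Term.var x ∈ a.2 := by
  simp only [conjVars, List.mem_flatMap, mem_termVars]

theorem mem_conjVars_iff_occursAt {x : ℕ} {A : Conj} : x ∈ conjVars A ↔ ∃ π, OccursAt x A π := by
  rw [mem_conjVars]
  constructor
  · rintro ⟨a, ha, hx⟩
    obtain ⟨i, hi⟩ := List.getElem?_of_mem hx
    exact ⟨⟨a.1, a.2.length, i⟩, a, ha, rfl, rfl, hi⟩
  · rintro ⟨π, a, ha, -, -, h⟩
    exact ⟨a, ha, List.mem_of_getElem? h⟩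

@[simp] theorem valueOf_var (h : ℕ → Value) (x : ℕ) : valueOf h (Sum.inr x) = h x := rfl

theorem map_valueOf_congr {h h' : ℕ → Value} {ts : List Term}
    (H : ∀ x, Term.var x ∈ ts → h x = h' x) : ts.map (valueOf h) = ts.map (valueOf h') := by
  refine List.map_congr_left fun t ht => ?_
  cases t with
  | inl c => rfl
  | inr x => exact H x ht

theorem isHom_congr {h h' : ℕ → Value} {A : Conj} {I : Instance}
    (H : ∀ x ∈ conjVars A, h x = h' x) : IsHom h A I ↔ IsHom h' A I := by
  refine forall₂_congr fun a ha => ?_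
  rw [map_valueOf_congr fun x hx => H x (mem_conjVars.2 ⟨a, ha, hx⟩)]

theorem map_valueOf_comp {φ : Value → Value} (hφ : ∀ c, φ (Value.const c) = Value.const c)
    (h : ℕ → Value) (ts : List Term) :
    (ts.map (valueOf h)).map φ = ts.map (valueOf (φ ∘ h)) := by
  rw [List.map_map]
  refine List.map_congr_left fun t _ => ?_
  cases t with
  | inl c => exact hφ c
  | inr x => rfl

theorem valueOf_sumMap (h : ℕ → Value) (o : ℕ → ℕ) (t : Term) :
    valueOf h (Sum.map id o t) = valueOf (h ∘ o) t := by
  cases t <;> rfl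

theorem le_foldr_max {l : List ℕ} {n : ℕ} (h : n ∈ l) : n ≤ l.foldr max 0 := by
  induction l with
  | nil => simp at h
  | cons a l ih =>
    rcases List.mem_cons.1 h with rfl | h
    · exact le_max_left _ _
    · exact (ih h).trans (le_max_right _ _)

theorem name_lt_freshName {S : Ontology} {σ : Rule} (hσ : σ ∈ S) {a : Atom}
    (ha : a ∈ σ.1 ∨ a ∈ σ.2) : a.1 < freshName S := by
  refine Nat.lt_succ_of_le (le_foldr_max (List.mem_flatMap.2 ⟨σ, hσ, ?_⟩))
  exact List.mem_map.2 ⟨a, List.mem_append.2 ha, rfl⟩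

theorem var_lt_freshVar {S : Ontology} {σ : Rule} (hσ : σ ∈ S) {x : ℕ}
    (hx : x ∈ conjVars σ.1 ∨ x ∈ conjVars σ.2) : x < freshVar S := by
  refine Nat.lt_succ_of_le (le_foldr_max (List.mem_flatMap.2 ⟨σ, hσ, ?_⟩))
  simp only [mem_conjVars, List.mem_append] at hx ⊢
  rcases hx with ⟨a, ha, h⟩ | ⟨a, ha, h⟩
  exacts [⟨a, Or.inl ha, h⟩, ⟨a, Or.inr ha, h⟩]

theorem Affected.name_lt {S : Ontology} {ρ : Rule} {z : ℕ} {π : Position}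
    (h : Affected S ρ z π) : π.name < freshName S := by
  cases h with
  | intro hρ hz hπ =>
    obtain ⟨a, ha, h, -⟩ := hπ
    exact h ▸ name_lt_freshName hρ (Or.inr ha)
  | propagate σ x hσ hx hπ hb =>
    obtain ⟨a, ha, h, -⟩ := hπ
    exact h ▸ name_lt_freshName hσ (Or.inr ha)

/-! ### Problematic and safe atoms -/

section Split

variable {S : Ontology} {σ : Rule}

theorem mem_pAtoms {a : Atom} : a ∈ pAtoms S σ ↔ a ∈ σ.1 ∧ Problematic S σ a := by
  simp [pAtoms]

theorem mem_sAtoms {a : Atom} : a ∈ sAtoms S σ ↔ a ∈ σ.1 ∧ ¬ Problematic S σ a := by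
  simp [sAtoms]

theorem mem_bridge {x : ℕ} : x ∈ bridge S σ ↔ x ∈ conjVars (sAtoms S σ) ∧
    (x ∈ conjVars (pAtoms S σ) ∨ (Harmless S σ x ∧ IsFrontier σ x)) := by
  simp [bridge]

theorem conjVars_pAtoms_subset {x : ℕ} (h : x ∈ conjVars (pAtoms S σ)) : x ∈ conjVars σ.1 := by
  obtain ⟨a, ha, hx⟩ := mem_conjVars.1 h
  exact mem_conjVars.2 ⟨a, (mem_pAtoms.1 ha).1, hx⟩

theorem conjVars_sAtoms_subset {x : ℕ} (h : x ∈ conjVars (sAtoms S σ)) : x ∈ conjVars σ.1 := by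
  obtain ⟨a, ha, hx⟩ := mem_conjVars.1 h
  exact mem_conjVars.2 ⟨a, (mem_sAtoms.1 ha).1, hx⟩

theorem mem_pAtoms_or_mem_sAtoms {a : Atom} (ha : a ∈ σ.1) :
    a ∈ pAtoms S σ ∨ a ∈ sAtoms S σ := by
  rw [mem_pAtoms, mem_sAtoms]
  tauto

theorem harmless_or_harmful {x : ℕ} (hx : x ∈ conjVars σ.1) :
    Harmless S σ x ∨ Harmful S σ x := by
  by_cases h : commonAff S σ x = ∅
  exacts [Or.inl ⟨hx, h⟩, Or.inr ⟨hx, h⟩]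

/-- A harmful variable shared with a problematic atom would make the safe atom problematic as well.
-/
theorem harmless_of_mem_bridge {x : ℕ} (h : x ∈ bridge S σ) : Harmless S σ x := by
  obtain ⟨hs, hp | h⟩ := mem_bridge.1 h
  · refine (harmless_or_harmful (conjVars_sAtoms_subset hs)).resolve_right fun hx => ?_
    obtain ⟨a, ha, hxa⟩ := mem_conjVars.1 hs
    obtain ⟨b, hb, hxb⟩ := mem_conjVars.1 hp
    rw [mem_sAtoms] at ha
    rw [mem_pAtoms] at hb
    exact ha.2 (.connected a b x ha.1 hb.2 (mem_termVars.2 hxa) (mem_termVars.2 hxb) hx)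
  · exact h.1

theorem mem_bridge_of_mem_of_mem {x : ℕ} (hp : x ∈ conjVars (pAtoms S σ))
    (hs : x ∈ conjVars (sAtoms S σ)) : x ∈ bridge S σ :=
  mem_bridge.2 ⟨hs, Or.inl hp⟩

/-- Every frontier variable occurs in the problematic atoms or is a bridge variable. -/
theorem IsFrontier.mem_pAtoms_or_mem_bridge {x : ℕ} (hx : IsFrontier σ x) :
    x ∈ conjVars (pAtoms S σ) ∨ x ∈ bridge S σ := by
  obtain ⟨a, ha, hxa⟩ := mem_conjVars.1 hx.1
  rcases mem_pAtoms_or_mem_sAtoms (S := S) ha with hp | hs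
  · exact Or.inl (mem_conjVars.2 ⟨a, hp, hxa⟩)
  · right
    refine mem_bridge.2 ⟨mem_conjVars.2 ⟨a, hs, hxa⟩, Or.inr ⟨?_, hx⟩⟩
    refine (harmless_or_harmful hx.1).resolve_right fun h => (mem_sAtoms.1 hs).2 ?_
    exact .dangerous a x ha (mem_termVars.2 hxa) ⟨h, hx⟩

end Split

/-! ### The renamed head -/

/-- The variable of the head `H` that the variable `y` of the renamed head stands for. -/
def origin (S : Ontology) (H : Conj) (y : ℕ) : ℕ :=
  if y < freshVar S then y else
    -- New names have the form `freshVar S + pair k (pair i j)`; unpairing recovers the place `(i,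
    -- j)` in the head. The default 0 is not reached for names that `pairedHead` introduces.
    let ij := (Nat.unpair (y - freshVar S)).2.unpair
    (((H[ij.1]?).bind fun a => a.2[ij.2]?).bind Sum.getRight?).getD 0

theorem origin_of_lt {S : Ontology} {H : Conj} {y : ℕ} (h : y < freshVar S) :
    origin S H y = y := if_pos h

/-- The new name of the argument `j` of the atom `i` in the head of the rule `k`. -/
def copyVar (S : Ontology) (k i j : ℕ) : ℕ := freshVar S + Nat.pair k (Nat.pair i j)

/-- The head of the rule `k`, with every argument paired with its renaming. -/
noncomputable def pairedHead (S : Ontology) (k : ℕ) (σ : Rule) : List (AtomOver (Term × Term)) :=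
  splitHead (bridge S σ) (copyVar S k) σ.2

/-- The pairs of different terms in the paired head. -/
noncomputable def renamedPairs (S : Ontology) (k : ℕ) (σ : Rule) : List (Term × Term) :=
  ((pairedHead S k σ).flatMap Prod.snd).filter fun p => p.1 ≠ p.2

/-- The arguments of `Aux_σ`. -/
noncomputable def auxArgs (S : Ontology) (k : ℕ) (σ : Rule) : List Term :=
  (bridge S σ).map Term.var ++ (renamedPairs S k σ).map Prod.snd

/-- The variables of the rule `σ` that the arguments of `Aux_σ` stand for. -/
noncomputable def auxVars (S : Ontology) (k : ℕ) (σ : Rule) : List ℕ :=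
  bridge S σ ++ termVars ((renamedPairs S k σ).map Prod.fst)

/-- The head of the main part of the rule `k`. -/
noncomputable def mainHead (S : Ontology) (k : ℕ) (σ : Rule) : Conj :=
  (pairedHead S k σ).map fun a => (a.1, a.2.map Prod.snd)

theorem mainRule_eq (S : Ontology) (k : ℕ) (σ : Rule) :
    mainRule S k σ = ((freshName S + k, auxArgs S k σ) :: pAtoms S σ, mainHead S k σ) := rfl

theorem splitHead_fst (B : List ℕ) (new : ℕ → ℕ → ℕ) (H : Conj) :
    (splitHead B new H).map (fun a => (a.1, a.2.map Prod.fst)) = H := by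
  refine List.ext_getElem (by simp [splitHead]) fun i h₁ h₂ => ?_
  simp only [splitHead, List.getElem_map, List.getElem_mapIdx]
  refine Prod.ext rfl (List.ext_getElem (by simp) fun j h₃ h₄ => ?_)
  simp only [List.getElem_map, List.getElem_mapIdx]
  split
  · simp_all
  · split <;> simp_all

theorem mem_splitHead {B : List ℕ} {new : ℕ → ℕ → ℕ} {H : Conj} {a : AtomOver (Term × Term)}
    (ha : a ∈ splitHead B new H) {p : Term × Term} (hp : p ∈ a.2) :
    p.1 = p.2 ∨ ∃ x i j, x ∈ B ∧ p = (Term.var x, Term.var (new i j)) ∧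
      ((H[i]?).bind fun b => b.2[j]?) = some (Term.var x) := by
  obtain ⟨i, hi, rfl⟩ := List.mem_iff_getElem.1 ha
  obtain ⟨j, hj, rfl⟩ := List.mem_iff_getElem.1 hp
  simp only [splitHead, List.length_mapIdx, List.getElem_mapIdx] at hi hj ⊢
  split
  · exact Or.inl rfl
  · rename_i x hx
    split_ifs with h
    · refine Or.inr ⟨x, i, j, h.1, rfl, ?_⟩
      simp [List.getElem?_eq_getElem hi, List.getElem?_eq_getElem hj, hx]
    · exact Or.inl rfl

section MainRule

variable {S : Ontology} {k : ℕ} {σ : Rule}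

theorem pairedHead_fst : (pairedHead S k σ).map (fun a => (a.1, a.2.map Prod.fst)) = σ.2 :=
  splitHead_fst _ _ _

theorem var_mem_head_of_mem_pairedHead {a : AtomOver (Term × Term)} (ha : a ∈ pairedHead S k σ)
    {p : Term × Term} (hp : p ∈ a.2) {x : ℕ} (hx : p.1 = Term.var x) : x ∈ conjVars σ.2 := by
  rw [← pairedHead_fst (S := S) (k := k) (σ := σ)]
  exact mem_conjVars.2 ⟨_, List.mem_map_of_mem ha, List.mem_map.2 ⟨p, hp, hx⟩⟩

/-- A pair of the paired head is of the form `(t, t)`, or it consists of a bridge variable and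
a new name for it. -/
theorem pairedHead_cases {a : AtomOver (Term × Term)} (ha : a ∈ pairedHead S k σ)
    {p : Term × Term} (hp : p ∈ a.2) :
    p.1 = p.2 ∨ ∃ x y, x ∈ bridge S σ ∧ p = (Term.var x, Term.var y) ∧ freshVar S ≤ y ∧
      origin S σ.2 y = x := by
  rcases mem_splitHead ha hp with h | ⟨x, i, j, hx, rfl, hij⟩
  · exact Or.inl h
  · refine Or.inr ⟨x, _, hx, rfl, Nat.le_add_right _ _, ?_⟩
    simp [origin, copyVar, hij]

theorem origin_pairedHead (hσ : σ ∈ S) {a : AtomOver (Term × Term)} (ha : a ∈ pairedHead S k σ)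
    {p : Term × Term} (hp : p ∈ a.2) : Sum.map id (origin S σ.2) p.2 = p.1 := by
  rcases pairedHead_cases ha hp with h | ⟨x, y, -, rfl, -, rfl⟩
  · rw [← h]
    rcases h1 : p.1 with c | x
    · rfl
    · simp [origin_of_lt (var_lt_freshVar hσ (Or.inr (var_mem_head_of_mem_pairedHead ha hp h1)))]
  · rfl

/-- Distinct names for repeated bridge variables are undone by a substitution, so homomorphisms for
the two heads can be compared by composing with `origin`. -/
theorem mainHead_origin (hσ : σ ∈ S) :
    (mainHead S k σ).map (fun a => (a.1, a.2.map (Sum.map id (origin S σ.2)))) = σ.2 := by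
  conv_rhs => rw [← pairedHead_fst (S := S) (k := k) (σ := σ)]
  rw [mainHead, List.map_map]
  refine List.map_congr_left fun a ha => Prod.ext rfl ?_
  simp only [Function.comp_apply, List.map_map]
  exact List.map_congr_left fun p hp => origin_pairedHead hσ ha hp

theorem mem_renamedPairs {p : Term × Term} (hp : p ∈ renamedPairs S k σ) :
    ∃ x y, x ∈ bridge S σ ∧ p = (Term.var x, Term.var y) ∧ freshVar S ≤ y ∧
      origin S σ.2 y = x := by
  simp only [renamedPairs, List.mem_filter, List.mem_flatMap, decide_eq_true_eq] at hp
  obtain ⟨⟨a, ha, hp⟩, hne⟩ := hp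
  exact (pairedHead_cases ha hp).resolve_left hne

theorem bridge_lt_freshVar (hσ : σ ∈ S) {x : ℕ} (hx : x ∈ bridge S σ) : x < freshVar S :=
  var_lt_freshVar hσ (Or.inl (harmless_of_mem_bridge hx).1)

/-- The same substitution identifies the arguments of Aux with the output tuple of `auxQuery`, where
a bridge variable may be repeated. -/
theorem auxArgs_origin (hσ : σ ∈ S) :
    (auxArgs S k σ).map (Sum.map id (origin S σ.2)) = (auxVars S k σ).map Term.var := by
  rw [auxArgs, auxVars, List.map_append, List.map_append, List.map_map]
  congr 1
  · refine List.map_congr_left fun x hx => ?_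
    simp [origin_of_lt (bridge_lt_freshVar hσ hx)]
  · have H := fun p => mem_renamedPairs (S := S) (k := k) (σ := σ) (p := p)
    generalize renamedPairs S k σ = l at H
    induction l with
    | nil => rfl
    | cons p l ih =>
      obtain ⟨x, y, -, rfl, -, rfl⟩ := H p List.mem_cons_self
      simpa [termVars] using ih fun p hp => H p (List.mem_cons_of_mem _ hp)

theorem mem_auxVars_iff {x : ℕ} : x ∈ auxVars S k σ ↔ x ∈ bridge S σ := by
  rw [auxVars, List.mem_append, or_iff_left_iff_imp, mem_termVars, List.mem_map]
  rintro ⟨p, hp, hx⟩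
  obtain ⟨x', y, h, rfl, -⟩ := mem_renamedPairs hp
  cases hx
  exact h

theorem var_mem_auxArgs {x : ℕ} (hx : x ∈ bridge S σ) : Term.var x ∈ auxArgs S k σ :=
  List.mem_append_left _ (List.mem_map_of_mem hx)

theorem origin_mem_bridge (hσ : σ ∈ S) {y : ℕ} (hy : Term.var y ∈ auxArgs S k σ) :
    origin S σ.2 y ∈ bridge S σ := by
  rw [← mem_auxVars_iff (k := k)]
  have := List.mem_map_of_mem (f := Sum.map id (origin S σ.2)) hy
  rw [auxArgs_origin hσ] at this
  simpa using this

/-- The variables of the head of a main rule: new names of bridge variables, and variables of the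
original rule. -/
theorem mainHead_var_cases (hσ : σ ∈ S) {y : ℕ} (hy : y ∈ conjVars (mainHead S k σ)) :
    y < freshVar S ∨ Term.var y ∈ auxArgs S k σ := by
  obtain ⟨b, hb, hy⟩ := mem_conjVars.1 hy
  obtain ⟨a, ha, rfl⟩ := List.mem_map.1 hb
  obtain ⟨p, hp, hpy⟩ := List.mem_map.1 hy
  rcases pairedHead_cases ha hp with h | ⟨x, y', hx, rfl, hy', rfl⟩
  · left
    exact var_lt_freshVar hσ (Or.inr (var_mem_head_of_mem_pairedHead ha hp (h.trans hpy)))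
  · right
    refine List.mem_append_right _ (List.mem_map.2 ⟨_, ?_, hpy⟩)
    simp only [renamedPairs, List.mem_filter, List.mem_flatMap, decide_eq_true_eq]
    refine ⟨⟨a, ha, hp⟩, fun h => ?_⟩
    have := bridge_lt_freshVar hσ hx
    have h' : origin S σ.2 y' = y' := Sum.inr.inj h
    omega

theorem mem_head_of_mem_mainHead (hσ : σ ∈ S) {a : Atom} (ha : a ∈ mainHead S k σ) :
    (a.1, a.2.map (Sum.map id (origin S σ.2))) ∈ σ.2 := by
  have := List.mem_map_of_mem (f := fun a : Atom => (a.1, a.2.map (Sum.map id (origin S σ.2)))) ha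
  rwa [mainHead_origin hσ] at this

theorem exists_mem_mainHead (hσ : σ ∈ S) {a : Atom} (ha : a ∈ σ.2) :
    ∃ b ∈ mainHead S k σ, a = (b.1, b.2.map (Sum.map id (origin S σ.2))) := by
  rw [← mainHead_origin (k := k) hσ] at ha
  obtain ⟨b, hb, h⟩ := List.mem_map.1 ha
  exact ⟨b, hb, h.symm⟩

end MainRule

theorem mem_mainPart {S : Ontology} {ρ : Rule} :
    ρ ∈ mainPart S ↔ ∃ k σ, S[k]? = some σ ∧ ρ = mainRule S k σ := by
  simp only [mainPart, List.mem_iff_getElem?, List.getElem?_mapIdx, Option.map_eq_some_iff]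
  simp only [eq_comm]

theorem getElem?_mainPart {S : Ontology} {k : ℕ} :
    (mainPart S)[k]? = (S[k]?).map (mainRule S k) := by
  simp [mainPart]

/-! ### Renaming of predicates and auxiliary facts -/

/-- Renames predicates such that the names of the predicates `Aux_σ` are not in the range. -/
def shiftName (S : Ontology) (n : ℕ) : ℕ := if n < freshName S then n else n + S.length

def shiftAtoms {α : Type} (S : Ontology) (A : List (AtomOver α)) : List (AtomOver α) :=
  A.map fun a => (shiftName S a.1, a.2)

theorem shiftName_of_lt {S : Ontology} {n : ℕ} (h : n < freshName S) : shiftName S n = n :=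
  if_pos h

theorem shiftName_injective (S : Ontology) : Function.Injective (shiftName S) := by
  intro m n h
  unfold shiftName at h
  split_ifs at h <;> omega

theorem shiftName_ne {S : Ontology} {n k : ℕ} (hk : k < S.length) :
    shiftName S n ≠ freshName S + k := by
  unfold shiftName
  split_ifs <;> omega

/-- The answers to this query are the arguments of the facts over `Aux_σ`. -/
noncomputable def auxQuery (S : Ontology) (k : ℕ) (σ : Rule) : CQ := (auxVars S k σ, sAtoms S σ)

/-- The names of the predicates `Aux_σ`, each with its query. -/
noncomputable def auxQueries (S : Ontology) : List (ℕ × CQ) :=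
  S.mapIdx fun k σ => (freshName S + k, auxQuery S k σ)

theorem mem_auxQueries {S : Ontology} {n : ℕ} {q : CQ} : (n, q) ∈ auxQueries S ↔
    ∃ k σ, S[k]? = some σ ∧ n = freshName S + k ∧ q = auxQuery S k σ := by
  simp only [auxQueries, List.mem_iff_getElem?, List.getElem?_mapIdx, Option.map_eq_some_iff,
    Prod.mk.injEq]
  simp only [eq_comm]

theorem auxQuery_wellFormed (S : Ontology) (k : ℕ) (σ : Rule) : (auxQuery S k σ).WellFormed :=
  fun _ hx => (mem_bridge.1 (mem_auxVars_iff.1 hx)).1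

/-- The constants of a database and of the heads of an ontology. -/
def domain (D : Database) (S : Ontology) : List ℕ :=
  D.flatMap Prod.snd ++ S.flatMap fun σ => σ.2.flatMap fun a => a.2.filterMap Sum.getLeft?

theorem mem_domain_of_mem_database {D : Database} {S : Ontology} {a : Fact} {c : ℕ} (ha : a ∈ D)
    (hc : c ∈ a.2) : c ∈ domain D S :=
  List.mem_append_left _ (List.mem_flatMap.2 ⟨a, ha, hc⟩)

theorem mem_domain_of_mem_head {D : Database} {S : Ontology} {σ : Rule} {a : Atom} {c : ℕ}
    (hσ : σ ∈ S) (ha : a ∈ σ.2) (hc : Term.const c ∈ a.2) : c ∈ domain D S :=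
  List.mem_append_right _ (List.mem_flatMap.2 ⟨σ, hσ, List.mem_flatMap.2
    ⟨a, ha, List.mem_filterMap.2 ⟨_, hc, rfl⟩⟩⟩)

/-- The tuples of length `n` over a list. -/
def tuples (U : List ℕ) : ℕ → List (List ℕ)
  | 0 => [[]]
  | n + 1 => (tuples U n).flatMap fun t => U.map fun u => u :: t

theorem mem_tuples {U : List ℕ} {n : ℕ} {t : List ℕ} :
    t ∈ tuples U n ↔ t.length = n ∧ ∀ c ∈ t, c ∈ U := by
  induction n generalizing t with
  | zero =>
    simp only [tuples, List.mem_singleton, List.length_eq_zero_iff]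
    constructor
    · rintro rfl
      simp
    · exact And.left
  | succ n ih =>
    simp only [tuples, List.mem_flatMap, List.mem_map, ih]
    constructor
    · rintro ⟨t, ⟨rfl, h⟩, u, hu, rfl⟩
      simpa [hu] using h
    · rintro ⟨hl, h⟩
      cases t with
      | nil => simp at hl
      | cons u t =>
        rw [List.forall_mem_cons] at h
        exact ⟨t, ⟨by simpa using hl, h.2⟩, u, h.1, rfl⟩

/-- The database and the facts `A`, over which the main part is evaluated. -/
def auxDatabase (S : Ontology) (D : Database) (A : Database) : Database := shiftAtoms S D ++ A

/-- The fact over some predicate `Aux_σ` is a certain answer to its query, given the facts `A`. -/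
def AuxStep (S : Ontology) (D : Database) (A : Database) (a : Fact) : Prop :=
  ∃ q : CQ, (a.1, q) ∈ auxQueries S ∧ a.2 ∈ tuples (domain D S) q.1.length ∧
    a.2 ∈ cert q (auxDatabase S D A) (mainPart S)

/-- Lists that are built from the end, such that every element is derivable from those after it. -/
inductive Derivation {α : Type} (P : List α → α → Prop) : List α → Prop
  | nil : Derivation P []
  | cons {a : α} {A : List α} : P A a → Derivation P A → Derivation P (a :: A)

/-! ### Soundness -/

/-- The extension of an instance by all the facts over the auxiliary predicates. -/
def auxModel (S : Ontology) (I : Instance) : Instance :=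
  {a | (∃ b ∈ I, a = (shiftName S b.1, b.2)) ∨
    ∃ k σ h, S[k]? = some σ ∧ IsHom h (sAtoms S σ) I ∧
      a = (freshName S + k, (auxVars S k σ).map h)}

section Soundness

variable {S : Ontology} {I : Instance}

theorem lt_length_of_getElem?_eq {α : Type} {l : List α} {k : ℕ} {a : α} (h : l[k]? = some a) :
    k < l.length :=
  (List.getElem?_eq_some_iff.1 h).1

theorem shiftName_mem_auxModel {n : ℕ} {ts : List Value} :
    (shiftName S n, ts) ∈ auxModel S I ↔ (n, ts) ∈ I := by
  constructor
  · rintro (⟨b, hb, h⟩ | ⟨k, σ, h, hk, -, hn⟩)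
    · obtain ⟨h₁, rfl⟩ := Prod.mk.inj h
      rwa [shiftName_injective S h₁]
    · exact absurd (Prod.mk.inj hn).1 (shiftName_ne (lt_length_of_getElem?_eq hk))
  · exact fun h => Or.inl ⟨_, h, rfl⟩

theorem mem_auxModel_of_lt {n : ℕ} {ts : List Value} (hn : n < freshName S) :
    (n, ts) ∈ auxModel S I ↔ (n, ts) ∈ I := by
  conv_lhs => rw [← shiftName_of_lt hn]
  exact shiftName_mem_auxModel

theorem isHom_auxModel {h : ℕ → Value} {A : Conj} (hA : ∀ a ∈ A, a.1 < freshName S) :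
    IsHom h A (auxModel S I) ↔ IsHom h A I :=
  forall₂_congr fun a ha => mem_auxModel_of_lt (hA a ha)

theorem isHom_shiftAtoms_auxModel {h : ℕ → Value} {A : Conj} :
    IsHom h (shiftAtoms S A) (auxModel S I) ↔ IsHom h A I := by
  simp only [IsHom, shiftAtoms, List.forall_mem_map, shiftName_mem_auxModel]

theorem pAtoms_name_lt {σ : Rule} (hσ : σ ∈ S) : ∀ a ∈ pAtoms S σ, a.1 < freshName S :=
  fun _ ha => name_lt_freshName hσ (Or.inl (mem_pAtoms.1 ha).1)

theorem sAtoms_name_lt {σ : Rule} (hσ : σ ∈ S) : ∀ a ∈ sAtoms S σ, a.1 < freshName S :=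
  fun _ ha => name_lt_freshName hσ (Or.inl (mem_sAtoms.1 ha).1)

theorem mainHead_name_lt {k : ℕ} {σ : Rule} (hσ : σ ∈ S) :
    ∀ a ∈ mainHead S k σ, a.1 < freshName S := fun a ha =>
  name_lt_freshName (a := (a.1, a.2.map (Sum.map id (origin S σ.2)))) hσ
    (Or.inr (mem_head_of_mem_mainHead hσ ha))

theorem mem_conjVars_mainRule {k : ℕ} {σ : Rule} {x : ℕ} :
    x ∈ conjVars (mainRule S k σ).1 ↔ Term.var x ∈ auxArgs S k σ ∨ x ∈ conjVars (pAtoms S σ) := by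
  simp [mainRule_eq, mem_conjVars]

theorem map_valueOf_auxArgs {k : ℕ} {σ : Rule} (hσ : σ ∈ S) (h : ℕ → Value) :
    (auxArgs S k σ).map (valueOf (h ∘ origin S σ.2)) = (auxVars S k σ).map h := by
  have := congrArg (List.map (valueOf h)) (auxArgs_origin (k := k) hσ)
  rw [List.map_map, List.map_map] at this
  rw [show valueOf (h ∘ origin S σ.2) = valueOf h ∘ Sum.map id (origin S σ.2) from
    funext fun t => (valueOf_sumMap h _ t).symm, this]
  rfl

/-- The Aux fact matched by the body comes with an assignment `h` of the safe atoms. It is glued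
with the given assignment `g` of the problematic atoms: variables common to both are bridge
variables, on which `g` and `h` agree. Then `σ` fires in `I`, and `origin` transfers the result to
the renamed head. -/
theorem satRule_auxModel {k : ℕ} {σ : Rule} (hk : S[k]? = some σ) (hI : SatRule I σ) :
    SatRule (auxModel S I) (mainRule S k σ) := by
  have hσ : σ ∈ S := List.mem_of_getElem? hk
  intro g hg
  rw [mainRule_eq] at hg
  obtain ⟨h, hs, hgh⟩ : ∃ h, IsHom h (sAtoms S σ) I ∧
      ∀ y, Term.var y ∈ auxArgs S k σ → g y = h (origin S σ.2 y) := by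
    rcases hg _ List.mem_cons_self with ⟨b, -, hb⟩ | ⟨k', σ', h, hk', hs, hk''⟩
    -- The range of `shiftName` avoids the Aux names, so this fact is not one of `I`.
    · exact absurd (Prod.mk.inj hb).1.symm (shiftName_ne (lt_length_of_getElem?_eq hk))
    · obtain ⟨h₁, h₂⟩ := Prod.mk.inj hk''
      obtain rfl : k = k' := Nat.add_left_cancel h₁
      obtain rfl : σ = σ' := Option.some.inj (hk.symm.trans hk')
      rw [← map_valueOf_auxArgs hσ] at h₂
      exact ⟨h, hs, fun y hy => List.map_inj_left.1 h₂ _ hy⟩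
  have hB : ∀ x ∈ bridge S σ, g x = h x := fun x hx => by
    rw [hgh x (var_mem_auxArgs hx), origin_of_lt (bridge_lt_freshVar hσ hx)]
  classical
  let u : ℕ → Value := fun x => if x ∈ conjVars (sAtoms S σ) then h x else g x
  have hus : ∀ x ∈ conjVars (sAtoms S σ), u x = h x := fun x hx => if_pos hx
  have hup : ∀ x ∈ conjVars (pAtoms S σ), u x = g x := fun x hx => by
    by_cases hxs : x ∈ conjVars (sAtoms S σ)
    · rw [hus x hxs, hB x (mem_bridge_of_mem_of_mem hx hxs)]
    · exact if_neg hxs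
  have hu : IsHom u σ.1 I := fun a ha => by
    rcases mem_pAtoms_or_mem_sAtoms (S := S) ha with h | h
    · refine (isHom_congr hup).2 ?_ a h
      exact (isHom_auxModel (pAtoms_name_lt hσ)).1 fun a ha => hg a (List.mem_cons_of_mem _ ha)
    · exact (isHom_congr hus).2 hs a h
  obtain ⟨h', hf, hh'⟩ := hI u hu
  refine ⟨h' ∘ origin S σ.2, fun x hx => ?_,
    (isHom_auxModel (mainHead_name_lt hσ)).2 fun a ha => ?_⟩
  · have hx₂ : origin S σ.2 x ∈ conjVars σ.2 := by
      obtain ⟨a, ha, hxa⟩ := mem_conjVars.1 hx.2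
      exact mem_conjVars.2 ⟨_, mem_head_of_mem_mainHead hσ ha, List.mem_map.2 ⟨_, hxa, rfl⟩⟩
    by_cases hxa : Term.var x ∈ auxArgs S k σ
    · have hxB := origin_mem_bridge hσ hxa
      have hxs := (mem_bridge.1 hxB).1
      rw [Function.comp_apply, hf _ ⟨conjVars_sAtoms_subset hxs, hx₂⟩, hus _ hxs, hgh x hxa]
    · have hxp := (mem_conjVars_mainRule.1 hx.1).resolve_left hxa
      have hx₁ := conjVars_pAtoms_subset hxp
      rw [Function.comp_apply]
      rw [origin_of_lt (var_lt_freshVar hσ (Or.inl hx₁))] at hx₂ ⊢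
      rw [hf x ⟨hx₁, hx₂⟩, hup x hxp]
  · have := hh' _ (mem_head_of_mem_mainHead hσ ha)
    simpa only [List.map_map, Function.comp_def, valueOf_sumMap] using this

theorem isModel_auxModel {D A : Database} (hI : IsModel D S I)
    (hA : ∀ a ∈ A, (a.1, a.2.map Value.const) ∈ auxModel S I) :
    IsModel (auxDatabase S D A) (mainPart S) (auxModel S I) := by
  refine ⟨fun a ha => ?_, fun ρ hρ => ?_⟩
  · rcases List.mem_append.1 ha with ha | ha
    · obtain ⟨b, hb, rfl⟩ := List.mem_map.1 ha
      exact shiftName_mem_auxModel.2 (hI.1 b hb)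
    · exact hA a ha
  · obtain ⟨k, σ, hk, rfl⟩ := mem_mainPart.1 hρ
    exact satRule_auxModel hk (hI.2 σ (List.mem_of_getElem? hk))

/-- By induction, `auxModel S I` is a model of the database with the facts derived so far, so the
next certain answer holds in it. The safe atoms use only old names, so its witness already lives in
`I`. -/
theorem derivation_subset_auxModel {D A : Database} (hI : IsModel D S I)
    (hA : Derivation (AuxStep S D) A) :
    ∀ a ∈ A, (a.1, a.2.map Value.const) ∈ auxModel S I := by
  induction hA with
  | nil => simp
  | @cons a A ha _ ih =>
    refine List.forall_mem_cons.2 ⟨?_, ih⟩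
    obtain ⟨q, hq, -, hc⟩ := ha
    obtain ⟨k, σ, hk, hn, rfl⟩ := mem_auxQueries.1 hq
    obtain ⟨h, hh, ht⟩ := hc _ (isModel_auxModel hI ih)
    refine Or.inr ⟨k, σ, h, hk, ?_, Prod.ext hn ht.symm⟩
    exact (isHom_auxModel (sAtoms_name_lt (List.mem_of_getElem? hk))).1 hh

theorem cert_of_cert_mainPart {D A : Database} (hA : Derivation (AuxStep S D) A) {q : CQ}
    {c : List ℕ} (hc : c ∈ cert (q.1, shiftAtoms S q.2) (auxDatabase S D A) (mainPart S)) :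
    c ∈ cert q D S := by
  intro I hI
  obtain ⟨h, hh, hq⟩ := hc _ (isModel_auxModel hI (derivation_subset_auxModel hI hA))
  exact ⟨h, isHom_shiftAtoms_auxModel.1 hh, hq⟩

end Soundness

/-! ### The Skolem chase -/

/-- The null for the existential variable `x` of the rule `k`, given the values of its body. -/
def skolemNull (k x : ℕ) (l : List Value) : Value := Value.null (Encodable.encode (k, x, l))

theorem skolemNull_injective {k x k' x' : ℕ} {l l' : List Value}
    (h : skolemNull k x l = skolemNull k' x' l') : k = k' ∧ x = x' ∧ l = l' := by
  simpa using Encodable.encode_injective (Sum.inr.inj h)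

/-- The extension of an assignment of the body variables of the rule `k` to the head. -/
def skolem (k : ℕ) (ρ : Rule) (h : ℕ → Value) (x : ℕ) : Value :=
  if x ∈ conjVars ρ.1 then h x else skolemNull k x ((conjVars ρ.1).map h)

/-- Nulls are codes of Skolem terms, determined by the rule, the existential variable and the values
of the body. Hence no stages are needed, and each null remembers the existential variable that it is
due to. -/
inductive Chase (D : Database) (R : Ontology) : Instance
  | base {a : Fact} (ha : a ∈ D) : Chase D R (a.1, a.2.map Value.const)
  | step {k : ℕ} {ρ : Rule} {h : ℕ → Value} {a : Atom} (hk : R[k]? = some ρ)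
      (hb : ∀ b ∈ ρ.1, Chase D R (b.1, b.2.map (valueOf h))) (ha : a ∈ ρ.2) :
      Chase D R (a.1, a.2.map (valueOf (skolem k ρ h)))

theorem lt_encode_of_mem {l : List Value} {m : ℕ} (h : Value.null m ∈ l) :
    m < Encodable.encode l := by
  induction l with
  | nil => simp at h
  | cons v l ih =>
    rw [Encodable.encode_list_cons]
    refine Nat.lt_succ_of_le ?_
    rcases List.mem_cons.1 h with rfl | h
    · refine le_trans ?_ (Nat.left_le_pair _ _)
      -- The code of `Sum.inr m` is `2 * m + 1`.
      change m ≤ 2 * m + 1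
      omega
    · exact (ih h).le.trans (Nat.right_le_pair _ _)

theorem lt_encode_skolem {k x : ℕ} {l : List Value} {m : ℕ} (h : Value.null m ∈ l) :
    m < Encodable.encode (k, x, l) :=
  (lt_encode_of_mem h).trans_le ((Nat.right_le_pair _ _).trans (Nat.right_le_pair _ _))

/-- The value of a null under the interpretation `E` of the Skolem functions. -/
def interpNull (E : ℕ → ℕ → List Value → Value) (n : ℕ) : Value :=
  match (Encodable.decode n : Option (ℕ × ℕ × List Value)) with
  | none => Value.const 0
  | some (k, x, l) => E k x (l.map fun v =>
      match v with
      | Sum.inl c => Value.const c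
      -- The test serves termination only: the nulls among the arguments of a Skolem term have
      -- smaller codes, by `lt_encode_skolem`.
      | Sum.inr m => if _h : m < n then interpNull E m else Value.const 0)
termination_by n

def interp (E : ℕ → ℕ → List Value → Value) : Value → Value := Sum.elim Value.const (interpNull E)

theorem interp_skolemNull (E : ℕ → ℕ → List Value → Value) (k x : ℕ) (l : List Value) :
    interp E (skolemNull k x l) = E k x (l.map (interp E)) := by
  change interpNull E _ = _
  rw [interpNull, Encodable.encodek]
  refine congrArg (E k x) (List.map_congr_left fun v hv => ?_)
  rcases v with c | m
  · rfl
  · exact dif_pos (lt_encode_skolem hv)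

/-- The assignment of the values `l` to the variables `V`. -/
def assignment (V : List ℕ) (l : List Value) (x : ℕ) : Value := l.getD (V.idxOf x) (Value.const 0)

theorem assignment_map {V : List ℕ} {h : ℕ → Value} {x : ℕ} (hx : x ∈ V) :
    assignment V (V.map h) x = h x := by
  have := List.idxOf_lt_length_of_mem hx
  simp [assignment, List.getD, List.getElem?_eq_getElem this]

/-- The chase is a universal model: it maps to every model. -/
theorem exists_chase_hom {D : Database} {R : Ontology} {J : Instance} (hJ : IsModel D R J) :
    ∃ φ : Value → Value, (∀ c, φ (Value.const c) = Value.const c) ∧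
      ∀ a, Chase D R a → (a.1, a.2.map φ) ∈ J := by
  have hE : ∀ (ρ : Rule) (g : ℕ → Value), ∃ h' : ℕ → Value, ρ ∈ R → IsHom g ρ.1 J →
      (∀ x, IsFrontier ρ x → h' x = g x) ∧ IsHom h' ρ.2 J := by
    intro ρ g
    by_cases h : ρ ∈ R ∧ IsHom g ρ.1 J
    · obtain ⟨h', hh'⟩ := hJ.2 ρ h.1 g h.2
      exact ⟨h', fun _ _ => hh'⟩
    · exact ⟨g, fun h₁ h₂ => absurd ⟨h₁, h₂⟩ h⟩
  choose ext hext using hE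
  -- The Skolem functions are interpreted by chosen witnesses for the rules in `J`. They are applied
  -- to the images of the body values, from which the body assignment is rebuilt.
  let E : ℕ → ℕ → List Value → Value := fun k x l =>
    (R[k]?).elim (Value.const 0) fun ρ => ext ρ (assignment (conjVars ρ.1) l) x
  refine ⟨interp E, fun _ => rfl, fun a ha => ?_⟩
  induction ha with
  | base ha =>
    rw [List.map_map]
    exact hJ.1 _ ha
  | @step k ρ h a hk _ ha ih =>
    let g := assignment (conjVars ρ.1) (((conjVars ρ.1).map h).map (interp E))
    have hg : ∀ x ∈ conjVars ρ.1, g x = (interp E ∘ h) x := fun x hx => by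
      simp only [g, List.map_map]
      exact assignment_map hx
    have hgJ : IsHom g ρ.1 J := (isHom_congr hg).2 fun b hb => by
      have := ih b hb
      rwa [map_valueOf_comp fun _ => rfl] at this
    obtain ⟨hf, hh⟩ := hext ρ g (List.mem_of_getElem? hk) hgJ
    have := hh a ha
    rw [map_valueOf_comp fun _ => rfl]
    rwa [map_valueOf_congr fun x hx => ?_] at this
    by_cases hx₁ : x ∈ conjVars ρ.1
    · rw [hf x ⟨hx₁, mem_conjVars.2 ⟨a, ha, hx⟩⟩, hg x hx₁, Function.comp_apply,
        Function.comp_apply, skolem, if_pos hx₁]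
    · rw [Function.comp_apply, skolem, if_neg hx₁, interp_skolemNull]
      simp only [E, hk, Option.elim]
      rfl

/-! ### Completeness -/

section Completeness

variable {S : Ontology} {D A : Database}

/-- The null `v` is due to an existential variable that affects the position `π`. -/
def NullAt (S : Ontology) (π : Position) (v : Value) : Prop :=
  ∃ k x l σ, v = skolemNull k x l ∧ S[k]? = some σ ∧ Affected S σ x π

theorem getElem?_map_valueOf {h : ℕ → Value} {ts : List Term} {i : ℕ} {v : Value}
    (hv : (ts.map (valueOf h))[i]? = some v) : ∃ t, ts[i]? = some t ∧ valueOf h t = v := by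
  simpa using hv

/-- If all the body positions of `x` hold nulls at affected positions, then a single existential
variable affects them. -/
theorem exists_affected_of_nullAt {A : Conj} {x : ℕ} {v : Value} (hx : x ∈ conjVars A)
    (H : ∀ π, OccursAt x A π → NullAt S π v) :
    ∃ k z l ρ, v = skolemNull k z l ∧ S[k]? = some ρ ∧ ∀ π, OccursAt x A π → Affected S ρ z π := by
  obtain ⟨π₀, hπ₀⟩ := mem_conjVars_iff_occursAt.1 hx
  obtain ⟨k, z, l, ρ, rfl, hk, -⟩ := H π₀ hπ₀
  refine ⟨k, z, l, ρ, rfl, hk, fun π hπ => ?_⟩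
  obtain ⟨k', z', l', ρ', hv, hk', hz'⟩ := H π hπ
  obtain ⟨rfl, rfl, -⟩ := skolemNull_injective hv
  obtain rfl : ρ = ρ' := Option.some.inj (hk.symm.trans hk')
  exact hz'

/-- Affectedness refers to `S`, although the chase is that of the main part. By induction: an
argument of Aux carries a constant, since positions of Aux are never affected. Another variable of
the main body occurs in problematic atoms only, so its affectedness propagates as in `S`. The
remaining head variables are existential in `S` too. -/
theorem chase_value {a : AtomOver Value} (hA : ∀ a ∈ A, ∀ c ∈ a.2, c ∈ domain D S)
    (ha : Chase (auxDatabase S D A) (mainPart S) a) {i : ℕ} {v : Value} (hv : a.2[i]? = some v) :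
    (∃ c ∈ domain D S, v = Value.const c) ∨ NullAt S ⟨a.1, a.2.length, i⟩ v := by
  induction ha generalizing i v with
  | @base a ha =>
    left
    simp only [List.getElem?_map, Option.map_eq_some_iff] at hv
    obtain ⟨c, hc, rfl⟩ := hv
    refine ⟨c, ?_, rfl⟩
    have hc := List.mem_of_getElem? hc
    rcases List.mem_append.1 ha with ha | ha
    · obtain ⟨b, hb, rfl⟩ := List.mem_map.1 ha
      exact mem_domain_of_mem_database hb hc
    · exact hA a ha c hc
  | @step k ρ h a hk _ ha ih =>
    rw [getElem?_mainPart, Option.map_eq_some_iff] at hk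
    obtain ⟨σ, hk, rfl⟩ := hk
    have hσ := List.mem_of_getElem? hk
    have haσ := mem_head_of_mem_mainHead hσ ha
    obtain ⟨t, ht, rfl⟩ := getElem?_map_valueOf hv
    simp only [List.length_map]
    rcases t with c | y
    · left
      refine ⟨c, mem_domain_of_mem_head hσ haσ ?_, rfl⟩
      exact List.mem_map.2 ⟨_, List.mem_of_getElem? ht, rfl⟩
    have ihp : ∀ π, OccursAt y (pAtoms S σ) π →
        (∃ c ∈ domain D S, h y = Value.const c) ∨ NullAt S π (h y) := by
      rintro ⟨n, m, j⟩ ⟨b, hb, rfl, rfl, hj⟩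
      have := @ih b (List.mem_cons_of_mem _ hb) j (h y) (by simp [hj])
      simpa only [List.length_map] using this
    have hyocc : origin S σ.2 y = y → OccursAt y σ.2 ⟨a.1, a.2.length, i⟩ := fun h =>
      ⟨_, haσ, rfl, by simp, by simp [ht, h]⟩
    simp only [valueOf_var, skolem]
    by_cases hya : Term.var y ∈ auxArgs S k σ
    · left
      rw [if_pos (mem_conjVars_mainRule.2 (Or.inl hya))]
      obtain ⟨j, hj⟩ := List.getElem?_of_mem hya
      refine (@ih (freshName S + k, auxArgs S k σ) List.mem_cons_self j (h y)
        (by simp [hj])).resolve_right ?_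
      rintro ⟨_, _, _, _, -, -, h⟩
      exact absurd h.name_lt (by simp)
    have hlt := (mainHead_var_cases hσ
      (mem_conjVars.2 ⟨a, ha, List.mem_of_getElem? ht⟩)).resolve_right hya
    have hocc := hyocc (origin_of_lt hlt)
    have hy₂ : y ∈ conjVars σ.2 := mem_conjVars_iff_occursAt.2 ⟨_, hocc⟩
    have hyB : y ∉ bridge S σ := fun h => hya (var_mem_auxArgs h)
    split_ifs with hy
    · have hyp := (mem_conjVars_mainRule.1 hy).resolve_left hya
      by_cases hc : ∃ c ∈ domain D S, h y = Value.const c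
      · exact Or.inl hc
      right
      obtain ⟨k', z, l, ρ, hn, hk', hz⟩ :=
        exists_affected_of_nullAt hyp fun π hπ => (ihp π hπ).resolve_left hc
      refine ⟨k', z, l, ρ, hn, hk', .propagate σ y hσ ⟨conjVars_pAtoms_subset hyp, hy₂⟩ hocc ?_⟩
      rintro π ⟨b, hb, hπ⟩
      refine hz π ⟨b, ?_, hπ⟩
      -- An occurrence in a safe atom would make `y` a bridge variable, so the problematic atoms
      -- account for all body positions of `y` in `σ`.
      refine (mem_pAtoms_or_mem_sAtoms hb).resolve_right fun hbs => hyB ?_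
      exact mem_bridge_of_mem_of_mem hyp (mem_conjVars.2 ⟨b, hbs, List.mem_of_getElem? hπ.2.2⟩)
    · right
      -- A frontier variable of `σ` is in a problematic atom or in the bridge, hence in the main
      -- body; so `y` is existential in `σ`.
      refine ⟨k, y, _, σ, rfl, hk, .intro hσ ⟨hy₂, fun hy₁ => ?_⟩ hocc⟩
      rcases IsFrontier.mem_pAtoms_or_mem_bridge (S := S) ⟨hy₁, hy₂⟩ with h | h
      · exact hy (mem_conjVars_mainRule.2 (Or.inr h))
      · exact hyB h

/-- The chase of the main part without the auxiliary facts. -/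
def chaseReduct (S : Ontology) (D A : Database) : Instance :=
  {a | Chase (auxDatabase S D A) (mainPart S) (shiftName S a.1, a.2)}

theorem isHom_chaseReduct_iff {h : ℕ → Value} {B : Conj} (hB : ∀ a ∈ B, a.1 < freshName S) :
    IsHom h B (chaseReduct S D A) ↔ IsHom h B (Chase (auxDatabase S D A) (mainPart S)) := by
  refine forall₂_congr fun a ha => ?_
  change Chase _ _ (shiftName S a.1, _) ↔ Chase _ _ _
  rw [shiftName_of_lt (hB a ha)]

/-- The homomorphism from the chase to a model fixes constants, so it preserves answers that consist
of constants. -/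
theorem mem_evalCQ_of_chase {D : Database} {R : Ontology} {q : CQ} {c : List ℕ}
    (h : c ∈ evalCQ q (Chase D R)) : c ∈ cert q D R := by
  intro J hJ
  obtain ⟨φ, hφ, hJ⟩ := exists_chase_hom hJ
  obtain ⟨h, hh, hq⟩ := h
  refine ⟨φ ∘ h, fun a ha => ?_, ?_⟩
  · rw [← map_valueOf_comp hφ]
    exact hJ _ (hh a ha)
  · rw [← List.map_map, hq, List.map_map]
    exact List.map_congr_left fun c _ => hφ c

theorem exists_map_const {l : List Value} {U : List ℕ}
    (h : ∀ v ∈ l, ∃ c ∈ U, v = Value.const c) :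
    ∃ t : List ℕ, l = t.map Value.const ∧ ∀ c ∈ t, c ∈ U := by
  induction l with
  | nil => exact ⟨[], rfl, by simp⟩
  | cons v l ih =>
    rw [List.forall_mem_cons] at h
    obtain ⟨⟨c, hc, rfl⟩, hl⟩ := h
    obtain ⟨t, rfl, ht⟩ := ih hl
    exact ⟨c :: t, rfl, List.forall_mem_cons.2 ⟨hc, ht⟩⟩

/-- A match `h` of the body of `σ` gives constants to the bridge variables. By universality, their
tuple is a certain answer to the query of Aux, so saturation puts the Aux fact into `A`. Hence the
main rule fires. -/
theorem satRule_chaseReduct (hA : ∀ a ∈ A, ∀ c ∈ a.2, c ∈ domain D S)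
    (hcl : ∀ a, AuxStep S D A a → a ∈ A) {σ : Rule} (hσ : σ ∈ S) :
    SatRule (chaseReduct S D A) σ := by
  obtain ⟨k, hk⟩ := List.getElem?_of_mem hσ
  intro h hh
  rw [isHom_chaseReduct_iff fun a ha => name_lt_freshName hσ (Or.inl ha)] at hh
  have hB : ∀ x ∈ bridge S σ, ∃ c ∈ domain D S, h x = Value.const c := by
    intro x hx
    by_contra hc
    obtain ⟨hx₁, hx⟩ := harmless_of_mem_bridge hx
    -- Otherwise `h x` is a null, and its existential variable affects all body positions of `x`,
    -- which contradicts harmlessness.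
    obtain ⟨k', z, l, ρ, -, -, hz⟩ := exists_affected_of_nullAt (S := S) (v := h x) hx₁ (by
      rintro ⟨n, m, j⟩ ⟨b, hb, rfl, rfl, hj⟩
      have := (chase_value hA (hh b hb) (i := j) (v := h x) (by simp [hj])).resolve_left hc
      simpa only [List.length_map] using this)
    exact Set.eq_empty_iff_forall_notMem.1 hx (ρ, z) hz
  obtain ⟨t, ht, htU⟩ : ∃ t : List ℕ, (auxVars S k σ).map h = t.map Value.const ∧
      ∀ c ∈ t, c ∈ domain D S := by
    refine exists_map_const fun v hv => ?_
    obtain ⟨x, hx, rfl⟩ := List.mem_map.1 hv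
    exact hB x (mem_auxVars_iff.1 hx)
  have haux : (freshName S + k, t) ∈ A := by
    refine hcl _ ⟨auxQuery S k σ, mem_auxQueries.2 ⟨k, σ, hk, rfl, rfl⟩, mem_tuples.2 ⟨?_, htU⟩, ?_⟩
    · simpa [auxQuery] using (congrArg List.length ht).symm
    · exact mem_evalCQ_of_chase ⟨h, fun a ha => hh a (mem_sAtoms.1 ha).1, ht⟩
  -- Composing with `origin` gives each new name the value of the bridge variable it stands for, so
  -- the names of one variable can be merged again (`hgo`).
  let g := skolem k (mainRule S k σ) (h ∘ origin S σ.2)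
  have hbody : ∀ b ∈ (mainRule S k σ).1, Chase (auxDatabase S D A) (mainPart S)
      (b.1, b.2.map (valueOf (h ∘ origin S σ.2))) := by
    rw [mainRule_eq]
    refine List.forall_mem_cons.2 ⟨?_, fun b hb => ?_⟩
    · rw [map_valueOf_auxArgs hσ, ht]
      exact .base (a := (freshName S + k, t)) (List.mem_append_right _ haux)
    · have hb := (mem_pAtoms.1 hb).1
      have := map_valueOf_congr (h := h ∘ origin S σ.2) (h' := h) fun x hx => congrArg h
        (origin_of_lt (var_lt_freshVar hσ (Or.inl (mem_conjVars.2 ⟨b, hb, hx⟩))))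
      rw [this]
      exact hh b hb
  have hgo : ∀ y ∈ conjVars (mainHead S k σ), g (origin S σ.2 y) = g y := by
    intro y hy
    rcases mainHead_var_cases hσ hy with h | hya
    · rw [origin_of_lt h]
    · have hyB := origin_mem_bridge hσ hya
      simp only [g, skolem]
      rw [if_pos (mem_conjVars_mainRule.2 (Or.inl (var_mem_auxArgs hyB))),
        if_pos (mem_conjVars_mainRule.2 (Or.inl hya)), Function.comp_apply, Function.comp_apply,
        origin_of_lt (bridge_lt_freshVar hσ hyB)]
  refine ⟨g, fun x hx => ?_, ?_⟩
  · have hxb : x ∈ conjVars (mainRule S k σ).1 :=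
      mem_conjVars_mainRule.2
        ((IsFrontier.mem_pAtoms_or_mem_bridge hx).symm.imp_left var_mem_auxArgs)
    simp only [g, skolem, if_pos hxb, Function.comp_apply,
      origin_of_lt (var_lt_freshVar hσ (Or.inl hx.1))]
  · rw [isHom_chaseReduct_iff fun a ha => name_lt_freshName hσ (Or.inr ha)]
    intro a ha
    obtain ⟨b, hb, rfl⟩ := exists_mem_mainHead (k := k) hσ ha
    have := Chase.step (D := auxDatabase S D A) (a := b)
      (getElem?_mainPart.trans (congrArg _ hk)) hbody hb
    change Chase _ _ _
    convert this using 2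
    rw [List.map_map]
    refine List.map_congr_left fun t ht => ?_
    rw [Function.comp_apply, valueOf_sumMap]
    rcases t with c | y
    · rfl
    · exact hgo y (mem_conjVars.2 ⟨b, hb, ht⟩)

theorem cert_mainPart_of_cert (hA : ∀ a ∈ A, ∀ c ∈ a.2, c ∈ domain D S)
    (hcl : ∀ a, AuxStep S D A a → a ∈ A) {q : CQ} {c : List ℕ} (hc : c ∈ cert q D S) :
    c ∈ cert (q.1, shiftAtoms S q.2) (auxDatabase S D A) (mainPart S) := by
  obtain ⟨h, hh, hq⟩ := hc (chaseReduct S D A) ⟨fun a ha => .base (a := (shiftName S a.1, a.2))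
    (List.mem_append_left _ (List.mem_map_of_mem (f := fun a => (shiftName S a.1, a.2)) ha)),
    fun σ hσ => satRule_chaseReduct hA hcl hσ⟩
  refine mem_evalCQ_of_chase ⟨h, fun a ha => ?_, hq⟩
  obtain ⟨b, hb, rfl⟩ := List.mem_map.1 ha
  exact hh b hb

end Completeness

/-! ### Correctness of the reduction, and existence of saturated derivations -/

theorem Derivation.forall_mem {α : Type} {P : List α → α → Prop} {Q : α → Prop}
    (h : ∀ A a, P A a → Q a) {A : List α} (hA : Derivation P A) : ∀ a ∈ A, Q a := by
  induction hA with
  | nil => simp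
  | cons ha _ ih => exact List.forall_mem_cons.2 ⟨h _ _ ha, ih⟩

/-- The certain answers are those over the main part, once the auxiliary facts are saturated. -/
theorem cert_iff_cert_mainPart {S : Ontology} {D A : Database} (hA : Derivation (AuxStep S D) A)
    (hcl : ∀ a, AuxStep S D A a → a ∈ A) {q : CQ} {c : List ℕ} :
    c ∈ cert (q.1, shiftAtoms S q.2) (auxDatabase S D A) (mainPart S) ↔ c ∈ cert q D S :=
  ⟨cert_of_cert_mainPart hA, cert_mainPart_of_cert
    (hA.forall_mem fun _ _ ⟨_, _, ht, _⟩ => (mem_tuples.1 ht).2) hcl⟩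

/-- Saturation: there is a derivation to which no candidate can be added. -/
theorem exists_saturated {α : Type} (P : List α → α → Prop) (U : List α)
    (hU : ∀ A a, P A a → a ∈ U) : ∃ A, Derivation P A ∧ ∀ a, P A a → a ∈ A := by
  classical
  -- Induction on a bound for the number of candidates not yet in the list.
  have key : ∀ n A, Derivation P A → U.toFinset.card - A.toFinset.card ≤ n →
      A.toFinset ⊆ U.toFinset → ∃ A, Derivation P A ∧ ∀ a, P A a → a ∈ A := by
    intro n
    induction n with
    | zero =>
      intro A hA hn hAU
      have hc := Finset.eq_of_subset_of_card_le hAU (Nat.sub_eq_zero_iff_le.1 (Nat.le_zero.1 hn))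
      refine ⟨A, hA, fun a ha => ?_⟩
      rw [← List.mem_toFinset, hc, List.mem_toFinset]
      exact hU A a ha
    | succ n ih =>
      intro A hA hn hAU
      by_cases hcl : ∀ a, P A a → a ∈ A
      · exact ⟨A, hA, hcl⟩
      push Not at hcl
      obtain ⟨a, ha, haA⟩ := hcl
      refine ih (a :: A) (.cons ha hA) ?_ ?_
      · rw [List.toFinset_cons, Finset.card_insert_of_notMem (by simpa using haA)]
        omega
      · rw [List.toFinset_cons]
        exact Finset.insert_subset (List.mem_toFinset.2 (hU A a ha)) hAU
  exact key _ [] .nil le_rfl (by simp)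

/-! ### Computability: lists and certificates -/

/-- Replaces the inductive definition by bounded quantifiers over suffixes, under which primitive
recursive predicates are closed. -/
theorem derivation_iff {α : Type} {P : List α → α → Prop} {A : List α} : Derivation P A ↔
    ∀ i ∈ List.range A.length, ∀ a ∈ (A[i]?).toList, P (A.drop (i + 1)) a := by
  induction A with
  | nil => simp [Derivation.nil]
  | cons b A ih =>
    have : Derivation P (b :: A) ↔ P A b ∧ Derivation P A :=
      ⟨fun h => by cases h with | cons h₁ h₂ => exact ⟨h₁, h₂⟩, fun h => .cons h.1 h.2⟩
    rw [this, ih, List.length_cons, List.range_succ_eq_map, List.forall_mem_cons]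
    simp

section Toolbox

variable {α β γ : Type} [Primcodable α] [Primcodable β] [Primcodable γ]

theorem primrecPred_ball {l : α → List β} {p : α → β → Prop} (hl : Primrec l)
    (hp : PrimrecPred fun x : α × β => p x.1 x.2) : PrimrecPred fun a => ∀ b ∈ l a, p a b :=
  (PrimrecRel.forall_mem_list (R := fun b a => p a b)
    (hp.comp (Primrec.snd.pair Primrec.fst))).comp hl Primrec.id

theorem primrecPred_bex {l : α → List β} {p : α → β → Prop} (hl : Primrec l)
    (hp : PrimrecPred fun x : α × β => p x.1 x.2) : PrimrecPred fun a => ∃ b ∈ l a, p a b :=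
  (PrimrecRel.exists_mem_list (R := fun b a => p a b)
    (hp.comp (Primrec.snd.pair Primrec.fst))).comp hl Primrec.id

theorem primrecPred_eq {f g : α → β} (hf : Primrec f) (hg : Primrec g) :
    PrimrecPred fun a => f a = g a :=
  Primrec.eq.comp hf hg

theorem primrecPred_mem {f : α → β} {l : α → List β} (hf : Primrec f) (hl : Primrec l) :
    PrimrecPred fun a => f a ∈ l a :=
  (primrecPred_bex (p := fun a b => b = f a) hl
    (primrecPred_eq Primrec.snd (hf.comp Primrec.fst))).of_eq fun a => by simp

theorem primrec_filter {l : α → List β} {p : α → β → Prop} [∀ a, DecidablePred (p a)]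
    (hl : Primrec l) (hp : PrimrecPred fun x : α × β => p x.1 x.2) :
    Primrec fun a => (l a).filter fun b => p a b := by
  have h := Primrec.ite hp (Primrec.option_some.comp Primrec.snd) (Primrec.const none)
  refine (Primrec.listFilterMap hl h.to₂).of_eq fun a => ?_
  rw [← List.filterMap_eq_filter]
  refine List.filterMap_congr fun b _ => ?_
  simp [Option.guard]

theorem primrec_mapIdx {l : α → List β} {g : α → ℕ → β → γ} (hl : Primrec l)
    (hg : Primrec fun x : α × ℕ × β => g x.1 x.2.1 x.2.2) :
    Primrec fun a => (l a).mapIdx (g a) := by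
  -- In a left fold, the length of the accumulated list is the current index.
  have h : Primrec₂ fun (a : α) (x : List γ × β) => x.1 ++ [g a x.1.length x.2] :=
    Primrec.list_concat.comp (Primrec.fst.comp Primrec.snd)
      (hg.comp (Primrec.fst.pair ((Primrec.list_length.comp (Primrec.fst.comp Primrec.snd)).pair
        (Primrec.snd.comp Primrec.snd))))
  refine (Primrec.list_foldl hl (Primrec.const []) h).of_eq fun a => ?_
  induction l a using List.reverseRecOn with
  | nil => rfl
  | append_singleton l b ih => simp [List.foldl_append, ih]

theorem primrec_dedup [DecidableEq β] {l : α → List β} (hl : Primrec l) :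
    Primrec fun a => (l a).dedup := by
  have h : Primrec₂ fun (_ : α) (x : β × List β) => if x.1 ∈ x.2 then x.2 else x.1 :: x.2 :=
    Primrec.ite (primrecPred_mem (Primrec.fst.comp Primrec.snd) (Primrec.snd.comp Primrec.snd))
      (Primrec.snd.comp Primrec.snd)
      (Primrec.list_cons.comp (Primrec.fst.comp Primrec.snd) (Primrec.snd.comp Primrec.snd))
  refine (Primrec.list_foldr hl (Primrec.const []) h).of_eq fun a => ?_
  induction l a with
  | nil => rfl
  | cons b l ih =>
    rw [List.foldr_cons, ih]
    by_cases hb : b ∈ l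
    · simp [hb, List.dedup_cons_of_mem]
    · simp [hb, List.dedup_cons_of_notMem]

theorem primrecPred_derivation {P : α → List β → β → Prop} {f : α → List β} (hf : Primrec f)
    (hP : PrimrecPred fun x : α × List β × β => P x.1 x.2.1 x.2.2) :
    PrimrecPred fun a => Derivation (P a) (f a) := by
  have h : PrimrecPred fun a => ∀ i ∈ List.range (f a).length, ∀ b ∈ ((f a)[i]?).toList,
      P a ((f a).drop (i + 1)) b := by
    refine primrecPred_ball (Primrec.list_range.comp (Primrec.list_length.comp hf)) ?_
    refine primrecPred_ball (Primrec.optionToList.comp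
      (Primrec.list_getElem?.comp (hf.comp Primrec.fst) Primrec.snd)) ?_
    refine hP.comp ((Primrec.fst.comp Primrec.fst).pair (.pair ?_ Primrec.snd))
    exact Primrec.list_drop.comp (Primrec.succ.comp (Primrec.snd.comp Primrec.fst))
      (hf.comp (Primrec.fst.comp Primrec.fst))
  exact h.of_eq fun a => derivation_iff.symm

/-- Certificates that exist can be found. -/
theorem exists_partrec_search {R : α → β → Prop} (hR : ComputablePred fun x : α × β => R x.1 x.2) :
    ∃ s : α →. β, Partrec s ∧ (∀ a b, b ∈ s a → R a b) ∧ ∀ a, (∃ b, R a b) → (s a).Dom := by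
  classical
  replace hR := hR.decide
  let f : α → ℕ → Option β := fun a n =>
    (Encodable.decode n : Option β).bind fun b => if R a b then some b else none
  have hf : Computable₂ f := by
    refine Computable.option_bind (Computable.decode.comp Computable.snd) ?_
    refine (Computable.cond (c := fun x : (α × ℕ) × β => decide (R x.1.1 x.2))
      (f := fun x => some x.2) (g := fun _ => none) ?_
      (Computable.option_some.comp Computable.snd) (Computable.const none)).of_eq fun x => ?_
    · exact hR.comp (g := fun x : (α × ℕ) × β => (x.1.1, x.2))
        ((Computable.fst.comp Computable.fst).pair Computable.snd)
    · by_cases h : R x.1.1 x.2 <;> simp [h]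
  refine ⟨fun a => Nat.rfindOpt (f a), Partrec.rfindOpt hf, fun a b hb => ?_, fun a ⟨b, hb⟩ => ?_⟩
  · obtain ⟨n, hn⟩ := Nat.rfindOpt_spec hb
    obtain ⟨b', -, hb'⟩ := Option.bind_eq_some_iff.1 hn
    split_ifs at hb' with h
    cases hb'
    exact h
  · refine Nat.rfindOpt_dom.2 ⟨Encodable.encode b, b, ?_⟩
    change (Encodable.decode (Encodable.encode b) : Option β).bind _ = some b
    rw [Encodable.encodek]
    exact if_pos hb

/-- Applies to functions defined without an algorithm: any certificate that the search finds
determines the value. -/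
theorem computable_of_certificate {R : α → β → Prop}
    (hR : ComputablePred fun x : α × β => R x.1 x.2) {f : α → γ} {g : α → β → γ}
    (hg : Computable₂ g) (hex : ∀ a, ∃ b, R a b) (h : ∀ a b, R a b → g a b = f a) :
    Computable f := by
  obtain ⟨s, hs, hsR, hdom⟩ := exists_partrec_search hR
  refine Partrec.of_eq_tot (hs.map hg) fun a => ?_
  obtain ⟨b, hb⟩ := Part.dom_iff_mem.1 (hdom a (hex a))
  rw [← h a b (hsR a b hb)]
  exact Part.mem_map _ hb

end Toolbox

/-! ### Computability: syntax -/

theorem primrec_getRight? : Primrec (Sum.getRight? : Term → Option ℕ) :=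
  (Primrec.sumCasesOn Primrec.id (Primrec.const none).to₂
    (Primrec.option_some.comp Primrec.snd).to₂).of_eq fun t => by cases t <;> rfl

theorem primrec_getLeft? : Primrec (Sum.getLeft? : Term → Option ℕ) :=
  (Primrec.sumCasesOn Primrec.id (Primrec.option_some.comp Primrec.snd).to₂
    (Primrec.const none).to₂).of_eq fun t => by cases t <;> rfl

theorem primrec_termVars : Primrec termVars :=
  Primrec.listFilterMap Primrec.id (primrec_getRight?.comp Primrec.snd).to₂

theorem primrec_conjVars : Primrec conjVars :=
  Primrec.list_flatMap Primrec.id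
    (primrec_termVars.comp (Primrec.snd.comp Primrec.snd)).to₂

theorem primrec_foldr_max : Primrec fun l : List ℕ => l.foldr max 0 :=
  Primrec.list_foldr Primrec.id (Primrec.const 0)
    (Primrec.nat_max.comp (Primrec.fst.comp Primrec.snd) (Primrec.snd.comp Primrec.snd)).to₂

theorem primrec_ruleAtoms : Primrec fun σ : Rule => σ.1 ++ σ.2 :=
  Primrec.list_append.comp Primrec.fst Primrec.snd

theorem primrec_freshName : Primrec freshName := by
  refine Primrec.succ.comp (primrec_foldr_max.comp (Primrec.list_flatMap Primrec.id ?_))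
  exact (Primrec.list_map (primrec_ruleAtoms.comp Primrec.snd)
    (Primrec.fst.comp Primrec.snd).to₂).to₂

theorem primrec_freshVar : Primrec freshVar :=
  Primrec.succ.comp (primrec_foldr_max.comp (Primrec.list_flatMap Primrec.id
    (primrec_conjVars.comp (primrec_ruleAtoms.comp Primrec.snd)).to₂))

/-- The positions of the conjunction `A` at which the term `t` occurs, as triples. -/
def positions (A : Conj) (t : Term) : List (ℕ × ℕ × ℕ) :=
  A.flatMap fun a => ((List.range a.2.length).filter fun i => a.2[i]? = some t).map
    fun i => (a.1, a.2.length, i)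

theorem mem_positions {A : Conj} {x : ℕ} {π : Position} :
    (π.name, π.arity, π.index) ∈ positions A (Term.var x) ↔ OccursAt x A π := by
  simp only [positions, List.mem_flatMap, List.mem_map, List.mem_filter, List.mem_range,
    decide_eq_true_eq, Prod.mk.injEq, OccursAt]
  refine exists_congr fun a => and_congr_right fun _ => ⟨?_, ?_⟩
  · rintro ⟨i, ⟨-, h⟩, h₁, h₂, rfl⟩
    exact ⟨h₁, h₂, h⟩
  · rintro ⟨h₁, h₂, h⟩
    exact ⟨_, ⟨lt_length_of_getElem?_eq h, h⟩, h₁, h₂, rfl⟩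

theorem forall_mem_positions {A : Conj} {x : ℕ} {P : ℕ × ℕ × ℕ → Prop} :
    (∀ π ∈ positions A (Term.var x), P π) ↔
      ∀ π : Position, OccursAt x A π → P (π.name, π.arity, π.index) :=
  ⟨fun h _ hπ => h _ (mem_positions.2 hπ), fun h π hπ => h ⟨π.1, π.2.1, π.2.2⟩ (mem_positions.1 hπ)⟩

theorem primrec_positions : Primrec₂ positions := by
  refine Primrec.list_flatMap Primrec.fst (Primrec.list_map (primrec_filter
    (l := fun x : (Conj × Term) × Atom => List.range x.2.2.length)
    (p := fun x i => x.2.2[i]? = some x.1.2) ?_ ?_)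
    (g := fun x i => (x.2.1, x.2.2.length, i)) ?_).to₂
  · exact Primrec.list_range.comp (Primrec.list_length.comp (Primrec.snd.comp Primrec.snd))
  · exact primrecPred_eq (Primrec.list_getElem?.comp
      (Primrec.snd.comp (Primrec.snd.comp Primrec.fst)) Primrec.snd)
      (Primrec.option_some.comp (Primrec.snd.comp (Primrec.fst.comp Primrec.fst)))
  · exact ((Primrec.fst.comp (Primrec.snd.comp Primrec.fst)).pair
      ((Primrec.list_length.comp (Primrec.snd.comp (Primrec.snd.comp Primrec.fst))).pair
        Primrec.snd)).to₂

theorem primrec_positions_var {α : Type} [Primcodable α] {f : α → Conj} {g : α → ℕ}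
    (hf : Primrec f) (hg : Primrec g) : Primrec fun a => positions (f a) (Term.var (g a)) :=
  primrec_positions.comp hf (Primrec.sumInr.comp hg)

/-- The existential variables of an ontology. -/
def exVars (S : Ontology) : List (Rule × ℕ) :=
  S.flatMap fun ρ => ((conjVars ρ.2).filter fun z => z ∉ conjVars ρ.1).map fun z => (ρ, z)

theorem mem_exVars {S : Ontology} {ρ : Rule} {z : ℕ} :
    (ρ, z) ∈ exVars S ↔ ρ ∈ S ∧ IsExVar ρ z := by
  simp [exVars, IsExVar]

theorem primrec_exVars : Primrec exVars := by
  refine Primrec.list_flatMap Primrec.id (Primrec.list_map (primrec_filter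
    (l := fun x : Ontology × Rule => conjVars x.2.2)
    (p := fun x z => z ∉ conjVars x.2.1) ?_ ?_) (g := fun x z => (x.2, z)) ?_).to₂
  · exact primrec_conjVars.comp (Primrec.snd.comp Primrec.snd)
  · exact (primrecPred_mem Primrec.snd (primrec_conjVars.comp
      (Primrec.fst.comp (Primrec.snd.comp Primrec.fst)))).not
  · exact ((Primrec.snd.comp Primrec.fst).pair Primrec.snd).to₂

/-! ### Affected positions -/

/-- A position together with an existential variable that affects it. -/
abbrev AffItem := (Rule × ℕ) × (ℕ × ℕ × ℕ)

/-- The position is affected, given that those in `L` are. -/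
def AffStep (S : Ontology) (L : List AffItem) (e : AffItem) : Prop :=
  e.1 ∈ exVars S ∧ (e.2 ∈ positions e.1.1.2 (Term.var e.1.2) ∨
    ∃ σ ∈ S, ∃ x ∈ conjVars σ.1, e.2 ∈ positions σ.2 (Term.var x) ∧
      ∀ π ∈ positions σ.1 (Term.var x), (e.1, π) ∈ L)

/-- A finite set that contains all affected positions. -/
def affCandidates (S : Ontology) : List AffItem :=
  (exVars S).flatMap fun e => S.flatMap fun σ => (conjVars σ.2).flatMap fun x =>
    (positions σ.2 (Term.var x)).map fun π => (e, π)

theorem mem_affCandidates {S : Ontology} {e : AffItem} : e ∈ affCandidates S ↔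
    e.1 ∈ exVars S ∧ ∃ σ ∈ S, ∃ x ∈ conjVars σ.2, e.2 ∈ positions σ.2 (Term.var x) := by
  simp only [affCandidates, List.mem_flatMap, List.mem_map]
  constructor
  · rintro ⟨e, he, σ, hσ, x, hx, π, hπ, rfl⟩
    exact ⟨he, σ, hσ, x, hx, hπ⟩
  · rintro ⟨he, σ, hσ, x, hx, hπ⟩
    exact ⟨_, he, σ, hσ, x, hx, _, hπ, rfl⟩

theorem mem_conjVars_of_mem_positions {A : Conj} {x : ℕ} {π : ℕ × ℕ × ℕ}
    (h : π ∈ positions A (Term.var x)) : x ∈ conjVars A :=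
  mem_conjVars_iff_occursAt.2 ⟨⟨π.1, π.2.1, π.2.2⟩, mem_positions.1 h⟩

theorem AffStep.mem_affCandidates {S : Ontology} {L : List AffItem} {e : AffItem}
    (h : AffStep S L e) : e ∈ affCandidates S := by
  refine DyadicTGD.mem_affCandidates.2 ⟨h.1, ?_⟩
  rcases h.2 with hπ | ⟨σ, hσ, x, -, hπ, -⟩
  · exact ⟨_, (mem_exVars.1 h.1).1, _, mem_conjVars_of_mem_positions hπ, hπ⟩
  · exact ⟨σ, hσ, x, mem_conjVars_of_mem_positions hπ, hπ⟩

/-- `L` lists the affected positions. -/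
def AffList (S : Ontology) (L : List AffItem) : Prop :=
  Derivation (AffStep S) L ∧ ∀ e ∈ affCandidates S, AffStep S L e → e ∈ L

theorem exists_affList (S : Ontology) : ∃ L, AffList S L := by
  obtain ⟨L, h₁, h₂⟩ := exists_saturated (AffStep S) (affCandidates S) fun _ _ h =>
    h.mem_affCandidates
  exact ⟨L, h₁, fun e _ => h₂ e⟩

/-- The premise of `propagate` is never vacuous, because a frontier variable occurs in the body; so
every derivation goes back to an `intro`. -/
theorem Affected.mem_exVars {S : Ontology} {ρ : Rule} {z : ℕ} {π : Position}
    (h : Affected S ρ z π) : (ρ, z) ∈ exVars S := by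
  induction h with
  | intro hρ hz hπ => exact DyadicTGD.mem_exVars.2 ⟨hρ, hz⟩
  | propagate σ x hσ hx hπ hb ih =>
    obtain ⟨π', hπ'⟩ := mem_conjVars_iff_occursAt.1 hx.1
    exact ih π' hπ'

/-- Being a derivation makes the list sound, by induction on the list; being closed makes it
complete, by induction on `Affected`. -/
theorem AffList.mem_iff {S : Ontology} {L : List AffItem} (hL : AffList S L) {ρ : Rule} {z : ℕ}
    {π : Position} : ((ρ, z), (π.name, π.arity, π.index)) ∈ L ↔ Affected S ρ z π := by
  constructor
  · have key : ∀ e ∈ L, Affected S e.1.1 e.1.2 ⟨e.2.1, e.2.2.1, e.2.2.2⟩ := by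
      replace hL := hL.1
      induction hL with
      | nil => simp
      | @cons e L he _ ih =>
        refine List.forall_mem_cons.2 ⟨?_, ih⟩
        rcases he.2 with hπ | ⟨σ, hσ, x, hx, hπ, hb⟩
        · have := DyadicTGD.mem_exVars.1 he.1
          exact .intro this.1 this.2 (mem_positions.1 hπ)
        · exact .propagate σ x hσ ⟨hx, mem_conjVars_of_mem_positions hπ⟩ (mem_positions.1 hπ)
            fun π' hπ' => ih _ (hb _ (mem_positions.2 hπ'))
    exact fun h => key _ h
  · intro h
    have hex := h.mem_exVars
    induction h with
    | intro hρ hz hπ =>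
      have : AffStep S L ((ρ, z), _) := ⟨hex, Or.inl (mem_positions.2 hπ)⟩
      exact hL.2 _ this.mem_affCandidates this
    | @propagate π σ x hσ hx hπ hb ih =>
      have : AffStep S L ((ρ, z), (π.name, π.arity, π.index)) :=
        ⟨hex, Or.inr ⟨σ, hσ, x, hx.1, mem_positions.2 hπ, forall_mem_positions.2 ih⟩⟩
      exact hL.2 _ this.mem_affCandidates this

theorem primrecPred_affStep :
    PrimrecPred fun x : Ontology × List AffItem × AffItem => AffStep x.1 x.2.1 x.2.2 := by
  have he : Primrec fun x : Ontology × List AffItem × AffItem => x.2.2 :=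
    Primrec.snd.comp Primrec.snd
  refine (primrecPred_mem (Primrec.fst.comp he) (primrec_exVars.comp Primrec.fst)).and
    ((primrecPred_mem (Primrec.snd.comp he) (primrec_positions_var
      (Primrec.snd.comp (Primrec.fst.comp (Primrec.fst.comp he)))
      (Primrec.snd.comp (Primrec.fst.comp he)))).or ?_)
  refine primrecPred_bex Primrec.fst ?_
  refine primrecPred_bex (primrec_conjVars.comp (Primrec.fst.comp Primrec.snd)) ?_
  refine (primrecPred_mem (Primrec.snd.comp (he.comp (Primrec.fst.comp Primrec.fst)))
    (primrec_positions_var (Primrec.snd.comp (Primrec.snd.comp Primrec.fst)) Primrec.snd)).and ?_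
  refine primrecPred_ball (primrec_positions_var
    (Primrec.fst.comp (Primrec.snd.comp Primrec.fst)) Primrec.snd) ?_
  exact primrecPred_mem ((Primrec.fst.comp (he.comp
    (Primrec.fst.comp (Primrec.fst.comp Primrec.fst)))).pair Primrec.snd)
    (Primrec.fst.comp (Primrec.snd.comp (Primrec.fst.comp (Primrec.fst.comp Primrec.fst))))

theorem primrec_affCandidates : Primrec affCandidates := by
  refine Primrec.list_flatMap primrec_exVars ?_
  refine Primrec.list_flatMap Primrec.fst ?_
  refine Primrec.list_flatMap (primrec_conjVars.comp (Primrec.snd.comp Primrec.snd)) ?_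
  refine Primrec.list_map (primrec_positions_var
    (Primrec.snd.comp (Primrec.snd.comp Primrec.fst)) Primrec.snd) ?_
  exact ((Primrec.snd.comp (Primrec.fst.comp (Primrec.fst.comp Primrec.fst))).pair Primrec.snd).to₂

theorem primrecPred_affList :
    PrimrecPred fun x : Ontology × List AffItem => AffList x.1 x.2 := by
  refine (primrecPred_derivation (P := fun x : Ontology × List AffItem => AffStep x.1)
    Primrec.snd ?_).and ?_
  · exact primrecPred_affStep.comp ((Primrec.fst.comp Primrec.fst).pair Primrec.snd)
  · refine primrecPred_ball (p := fun x e => AffStep x.1 x.2 e → e ∈ x.2)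
      (primrec_affCandidates.comp Primrec.fst) ?_
    refine PrimrecPred.of_eq (PrimrecPred.or (PrimrecPred.not (primrecPred_affStep.comp
      (f := fun x : (Ontology × List AffItem) × AffItem => (x.1.1, x.1.2, x.2))
      ((Primrec.fst.comp Primrec.fst).pair
        ((Primrec.snd.comp Primrec.fst).pair Primrec.snd))))
      (primrecPred_mem Primrec.snd (Primrec.snd.comp Primrec.fst))) fun x => ?_
    exact imp_iff_not_or.symm

/-! ### Problematic atoms -/

/-- `Harmful`, in terms of a list of the affected positions. -/
def HarmfulIn (S : Ontology) (L : List AffItem) (σ : Rule) (x : ℕ) : Prop :=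
  x ∈ conjVars σ.1 ∧ ∃ e ∈ exVars S, ∀ π ∈ positions σ.1 (Term.var x), (e, π) ∈ L

/-- The search for an affecting variable may be restricted to the finite list `exVars S`, since `x`
has some body position and whatever affects it is listed there. -/
theorem AffList.harmfulIn_iff {S : Ontology} {L : List AffItem} (hL : AffList S L) {σ : Rule}
    {x : ℕ} : HarmfulIn S L σ x ↔ Harmful S σ x := by
  refine and_congr_right fun hx => ?_
  rw [← Set.nonempty_iff_ne_empty]
  constructor
  · rintro ⟨e, -, he⟩
    exact ⟨e, fun π hπ => hL.mem_iff.1 (he _ (mem_positions.2 hπ))⟩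
  · rintro ⟨e, he⟩
    obtain ⟨π, hπ⟩ := mem_conjVars_iff_occursAt.1 hx
    have h : Affected S e.1 e.2 π := he π hπ
    exact ⟨e, h.mem_exVars, forall_mem_positions.2 fun π hπ => hL.mem_iff.2 (he π hπ)⟩

theorem primrecPred_harmfulIn : PrimrecPred fun x : (Ontology × List AffItem) × Rule × ℕ =>
    HarmfulIn x.1.1 x.1.2 x.2.1 x.2.2 := by
  have hσ : Primrec fun x : (Ontology × List AffItem) × Rule × ℕ => x.2.1.1 :=
    Primrec.fst.comp (Primrec.fst.comp Primrec.snd)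
  have hx : Primrec fun x : (Ontology × List AffItem) × Rule × ℕ => x.2.2 :=
    Primrec.snd.comp Primrec.snd
  refine (primrecPred_mem hx (primrec_conjVars.comp hσ)).and ?_
  refine primrecPred_bex (primrec_exVars.comp (Primrec.fst.comp Primrec.fst)) ?_
  refine primrecPred_ball (primrec_positions_var (hσ.comp Primrec.fst) (hx.comp Primrec.fst)) ?_
  exact primrecPred_mem ((Primrec.snd.comp Primrec.fst).pair Primrec.snd)
    (Primrec.snd.comp (Primrec.fst.comp (Primrec.fst.comp Primrec.fst)))

/-- An atom together with a rule for which it is problematic. -/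
abbrev ProbItem := Rule × Atom

/-- The atom is problematic, given that those in `M` are. -/
def ProbStep (S : Ontology) (L : List AffItem) (M : List ProbItem) (e : ProbItem) : Prop :=
  e.2 ∈ e.1.1 ∧ ∃ x ∈ termVars e.2.2, HarmfulIn S L e.1 x ∧
    (x ∈ conjVars e.1.2 ∨ ∃ b ∈ e.1.1, (e.1, b) ∈ M ∧ x ∈ termVars b.2)

/-- All pairs of a rule and an atom of its body. -/
def bodyItems (S : Ontology) : List ProbItem := S.flatMap fun σ => σ.1.map fun a => (σ, a)

theorem mem_bodyItems {S : Ontology} {e : ProbItem} :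
    e ∈ bodyItems S ↔ e.1 ∈ S ∧ e.2 ∈ e.1.1 := by
  obtain ⟨σ, a⟩ := e
  simp [bodyItems]

/-- `M` lists the problematic atoms. -/
def ProbList (S : Ontology) (L : List AffItem) (M : List ProbItem) : Prop :=
  Derivation (fun M e => e ∈ bodyItems S ∧ ProbStep S L M e) M ∧
    ∀ e ∈ bodyItems S, ProbStep S L M e → e ∈ M

theorem exists_probList (S : Ontology) (L : List AffItem) : ∃ M, ProbList S L M := by
  obtain ⟨M, h₁, h₂⟩ := exists_saturated (fun M e => e ∈ bodyItems S ∧ ProbStep S L M e)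
    (bodyItems S) fun _ _ h => h.1
  exact ⟨M, h₁, fun e he h => h₂ e ⟨he, h⟩⟩

theorem Problematic.mem_body {S : Ontology} {σ : Rule} {a : Atom} (h : Problematic S σ a) :
    a ∈ σ.1 := by
  cases h <;> assumption

/-- As for affected positions: the derivation gives one direction, closure under steps the other. -/
theorem ProbList.mem_iff {S : Ontology} {L : List AffItem} {M : List ProbItem} (hL : AffList S L)
    (hM : ProbList S L M) {σ : Rule} (hσ : σ ∈ S) {a : Atom} :
    (σ, a) ∈ M ↔ Problematic S σ a := by
  constructor
  · have key : ∀ e ∈ M, Problematic S e.1 e.2 := by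
      replace hM := hM.1
      induction hM with
      | nil => simp
      | @cons e M he _ ih =>
        refine List.forall_mem_cons.2 ⟨?_, ih⟩
        obtain ⟨-, ha, x, hx, hh, h | ⟨b, -, hbM, hxb⟩⟩ := he
        · exact .dangerous _ x ha hx ⟨hL.harmfulIn_iff.1 hh, hh.1, h⟩
        · exact .connected _ b x ha (ih _ hbM) hx hxb (hL.harmfulIn_iff.1 hh)
    exact fun h => key _ h
  · intro h
    induction h with
    | dangerous a x ha hx hd =>
      exact hM.2 _ (mem_bodyItems.2 ⟨hσ, ha⟩)
        ⟨ha, x, hx, hL.harmfulIn_iff.2 hd.1, Or.inl hd.2.2⟩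
    | connected a b x ha hb hxa hxb hx ih =>
      exact hM.2 _ (mem_bodyItems.2 ⟨hσ, ha⟩)
        ⟨ha, x, hxa, hL.harmfulIn_iff.2 hx, Or.inr ⟨b, hb.mem_body, ih, hxb⟩⟩

theorem primrec_bodyItems : Primrec bodyItems :=
  Primrec.list_flatMap Primrec.id (Primrec.list_map (g := fun x a => (x.2, a))
    (Primrec.fst.comp Primrec.snd) ((Primrec.snd.comp Primrec.fst).pair Primrec.snd).to₂).to₂

theorem primrecPred_probStep :
    PrimrecPred fun x : (Ontology × List AffItem) × List ProbItem × ProbItem =>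
      ProbStep x.1.1 x.1.2 x.2.1 x.2.2 := by
  have he : Primrec fun x : (Ontology × List AffItem) × List ProbItem × ProbItem => x.2.2 :=
    Primrec.snd.comp Primrec.snd
  have hσ := Primrec.fst.comp he
  refine (primrecPred_mem (Primrec.snd.comp he) (Primrec.fst.comp hσ)).and ?_
  refine primrecPred_bex (primrec_termVars.comp (Primrec.snd.comp (Primrec.snd.comp he))) ?_
  refine (primrecPred_harmfulIn.comp ((Primrec.fst.comp Primrec.fst).pair
    ((hσ.comp Primrec.fst).pair Primrec.snd))).and ?_
  refine (primrecPred_mem Primrec.snd (primrec_conjVars.comp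
    (Primrec.snd.comp (hσ.comp Primrec.fst)))).or ?_
  refine primrecPred_bex (Primrec.fst.comp (hσ.comp Primrec.fst)) ?_
  refine (primrecPred_mem ((hσ.comp (Primrec.fst.comp Primrec.fst)).pair Primrec.snd)
    (Primrec.fst.comp (Primrec.snd.comp (Primrec.fst.comp Primrec.fst)))).and ?_
  exact primrecPred_mem (Primrec.snd.comp Primrec.fst)
    (primrec_termVars.comp (Primrec.snd.comp Primrec.snd))

theorem primrecPred_probList :
    PrimrecPred fun x : (Ontology × List AffItem) × List ProbItem =>
      ProbList x.1.1 x.1.2 x.2 := by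
  refine (primrecPred_derivation (P := fun (x : (Ontology × List AffItem) × List ProbItem) M e =>
    e ∈ bodyItems x.1.1 ∧ ProbStep x.1.1 x.1.2 M e) Primrec.snd ?_).and ?_
  · refine (primrecPred_mem (Primrec.snd.comp Primrec.snd) (primrec_bodyItems.comp
      (Primrec.fst.comp (Primrec.fst.comp Primrec.fst)))).and ?_
    exact primrecPred_probStep.comp ((Primrec.fst.comp Primrec.fst).pair Primrec.snd)
  · refine primrecPred_ball (p := fun x e => ProbStep x.1.1 x.1.2 x.2 e → e ∈ x.2)
      (primrec_bodyItems.comp (Primrec.fst.comp Primrec.fst)) ?_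
    refine PrimrecPred.of_eq (PrimrecPred.or (PrimrecPred.not (primrecPred_probStep.comp
      (f := fun x : ((Ontology × List AffItem) × List ProbItem) × ProbItem =>
        (x.1.1, x.1.2, x.2))
      ((Primrec.fst.comp Primrec.fst).pair
        ((Primrec.snd.comp Primrec.fst).pair Primrec.snd))))
      (primrecPred_mem Primrec.snd (Primrec.snd.comp Primrec.fst))) fun x => ?_
    exact imp_iff_not_or.symm

/-! ### Computability of the main part -/

/-- The problematic and the safe body atoms and the bridge variables. -/
abbrev SplitData := Conj × Conj × List ℕ

/-- The main rule, and the name of its auxiliary predicate with its query, in terms of the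
problematic and the safe atoms and the bridge variables. -/
def ruleOfSplit (S : Ontology) (k : ℕ) (σ : Rule) (d : SplitData) : Rule × ℕ × CQ :=
  let H := splitHead d.2.2 (copyVar S k) σ.2
  let R := (H.flatMap Prod.snd).filter fun p => p.1 ≠ p.2
  (((freshName S + k, d.2.2.map Term.var ++ R.map Prod.snd) :: d.1,
      H.map fun a => (a.1, a.2.map Prod.snd)),
    freshName S + k, d.2.2 ++ termVars (R.map Prod.fst), d.2.1)

theorem ruleOfSplit_eq (S : Ontology) (k : ℕ) (σ : Rule) :
    ruleOfSplit S k σ (pAtoms S σ, sAtoms S σ, bridge S σ) =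
      (mainRule S k σ, freshName S + k, auxQuery S k σ) := rfl

open Classical in
/-- The problematic and the safe atoms and the bridge variables, in terms of lists of the affected
positions and of the problematic atoms. -/
noncomputable def splitIn (S : Ontology) (L : List AffItem) (M : List ProbItem) (σ : Rule) :
    SplitData :=
  let p := σ.1.filter fun a => (σ, a) ∈ M
  let s := σ.1.filter fun a => (σ, a) ∉ M
  (p, s, (conjVars s).dedup.filter fun x =>
    x ∈ conjVars p ∨ (¬ HarmfulIn S L σ x ∧ x ∈ conjVars σ.1 ∧ x ∈ conjVars σ.2))

theorem splitIn_eq {S : Ontology} {L : List AffItem} {M : List ProbItem} (hL : AffList S L)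
    (hM : ProbList S L M) {σ : Rule} (hσ : σ ∈ S) :
    splitIn S L M σ = (pAtoms S σ, sAtoms S σ, bridge S σ) := by
  have hp : (splitIn S L M σ).1 = pAtoms S σ :=
    List.filter_congr fun a _ => decide_eq_decide.2 (hM.mem_iff hL hσ)
  have hs : (splitIn S L M σ).2.1 = sAtoms S σ :=
    List.filter_congr fun a _ => decide_eq_decide.2 (not_congr (hM.mem_iff hL hσ))
  refine Prod.ext hp (Prod.ext hs ?_)
  change List.filter _ (conjVars (splitIn S L M σ).2.1).dedup = List.filter _ _
  rw [hs]
  refine List.filter_congr fun x _ => decide_eq_decide.2 ?_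
  change x ∈ conjVars (splitIn S L M σ).1 ∨ _ ↔ _
  rw [hp, hL.harmfulIn_iff]
  refine or_congr_right ⟨fun ⟨h₁, h₂⟩ => ⟨?_, h₂⟩, fun ⟨h₁, h₂⟩ => ⟨fun h => h.2 h₁.2, h₂⟩⟩
  exact (harmless_or_harmful h₂.1).resolve_right h₁

theorem primrec_splitIn : Primrec fun x : ((Ontology × List AffItem) × List ProbItem) × Rule =>
    splitIn x.1.1.1 x.1.1.2 x.1.2 x.2 := by
  classical
  let X := ((Ontology × List AffItem) × List ProbItem) × Rule
  have hmem : PrimrecPred fun y : X × Atom => (y.1.2, y.2) ∈ y.1.1.2 :=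
    primrecPred_mem ((Primrec.snd.comp Primrec.fst).pair Primrec.snd)
      (Primrec.snd.comp (Primrec.fst.comp Primrec.fst))
  have hb : Primrec fun x : X => x.2.1 := Primrec.fst.comp Primrec.snd
  have hp : Primrec fun x : X => x.2.1.filter fun a => (x.2, a) ∈ x.1.2 :=
    primrec_filter (p := fun x a => (x.2, a) ∈ x.1.2) hb hmem
  have hs : Primrec fun x : X => x.2.1.filter fun a => (x.2, a) ∉ x.1.2 :=
    primrec_filter (p := fun x a => (x.2, a) ∉ x.1.2) hb hmem.not
  have hctx : Primrec fun y : X × ℕ => y.1.1.1 := Primrec.fst.comp (Primrec.fst.comp Primrec.fst)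
  have hσ : Primrec fun y : X × ℕ => y.1.2 := Primrec.snd.comp Primrec.fst
  have hx : Primrec fun y : X × ℕ => y.2 := Primrec.snd
  have hpx : PrimrecPred fun y : X × ℕ =>
      y.2 ∈ conjVars (y.1.2.1.filter fun a => (y.1.2, a) ∈ y.1.1.2) :=
    primrecPred_mem hx (primrec_conjVars.comp (hp.comp Primrec.fst))
  have hharm : PrimrecPred fun y : X × ℕ => ¬ HarmfulIn y.1.1.1.1 y.1.1.1.2 y.1.2 y.2 :=
    PrimrecPred.not (primrecPred_harmfulIn.comp (hctx.pair (hσ.pair hx)) :)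
  have hfr : PrimrecPred fun y : X × ℕ => y.2 ∈ conjVars y.1.2.1 ∧ y.2 ∈ conjVars y.1.2.2 :=
    (primrecPred_mem hx (primrec_conjVars.comp (Primrec.fst.comp hσ))).and
      (primrecPred_mem hx (primrec_conjVars.comp (Primrec.snd.comp hσ)))
  have hB := primrec_filter (p := fun (x : X) y =>
    y ∈ conjVars (x.2.1.filter fun a => (x.2, a) ∈ x.1.2) ∨
      (¬ HarmfulIn x.1.1.1 x.1.1.2 x.2 y ∧ y ∈ conjVars x.2.1 ∧ y ∈ conjVars x.2.2))
    (primrec_dedup (primrec_conjVars.comp hs)) (hpx.or (hharm.and hfr))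
  refine (hp.pair (hs.pair hB)).of_eq fun x => ?_
  simp only [splitIn]

theorem primrec_copyVar : Primrec fun x : (Ontology × ℕ) × ℕ × ℕ =>
    copyVar x.1.1 x.1.2 x.2.1 x.2.2 :=
  Primrec.nat_add.comp (primrec_freshVar.comp (Primrec.fst.comp Primrec.fst))
    (Primrec₂.natPair.comp (Primrec.snd.comp Primrec.fst)
      (Primrec₂.natPair.comp (Primrec.fst.comp Primrec.snd) (Primrec.snd.comp Primrec.snd)))

/-- An argument of a head, paired with its new name `y` if it is a variable of both `B` and `V`. -/
def splitArg (B V : List ℕ) (y : ℕ) (t : Term) : Term × Term :=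
  Sum.elim (fun c => (Term.const c, Term.const c))
    (fun x => if x ∈ B ∧ x ∈ V then (Term.var x, Term.var y) else (Term.var x, Term.var x)) t

/-- This form replaces the match by `Sum.elim` and the two membership tests by one in a
concatenation, in preparation for `primrec_splitHead`. -/
theorem splitHead_eq (B : List ℕ) (new : ℕ → ℕ → ℕ) (H : Conj) :
    splitHead B new H = H.mapIdx fun i a => (a.1, a.2.mapIdx fun j t =>
      splitArg B (conjVars (H.take i) ++ termVars (a.2.take j)) (new i j) t) := by
  unfold splitHead
  congr! 7 with i a j t
  rcases t with c | x
  · rfl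
  · simp [splitArg]

theorem primrec_splitArg : Primrec fun x : (List ℕ × List ℕ) × ℕ × Term =>
    splitArg x.1.1 x.1.2 x.2.1 x.2.2 := by
  let X := ((List ℕ × List ℕ) × ℕ × Term) × ℕ
  have hconst : Primrec fun y : X => Term.const y.2 := Primrec.sumInl.comp Primrec.snd
  have hvar : Primrec fun y : X => Term.var y.2 := Primrec.sumInr.comp Primrec.snd
  have hnew : Primrec fun y : X => Term.var y.1.2.1 :=
    Primrec.sumInr.comp (Primrec.fst.comp (Primrec.snd.comp Primrec.fst))
  have hB : PrimrecPred fun y : X => y.2 ∈ y.1.1.1 ∧ y.2 ∈ y.1.1.2 :=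
    (primrecPred_mem Primrec.snd (Primrec.fst.comp (Primrec.fst.comp Primrec.fst))).and
      (primrecPred_mem Primrec.snd (Primrec.snd.comp (Primrec.fst.comp Primrec.fst)))
  refine (Primrec.sumCasesOn (f := fun x : (List ℕ × List ℕ) × ℕ × Term => x.2.2)
    (Primrec.snd.comp Primrec.snd) (hconst.pair hconst).to₂
    (Primrec.ite hB (hvar.pair hnew) (hvar.pair hvar)).to₂).of_eq fun x => ?_
  rcases x with ⟨_, _, _ | _⟩ <;> rfl

theorem primrec_splitHead : Primrec fun x : ((Ontology × ℕ) × List ℕ) × Conj =>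
    splitHead x.1.2 (copyVar x.1.1.1 x.1.1.2) x.2 := by
  let HeadCtx := ((Ontology × ℕ) × List ℕ) × Conj
  let ArgCtx := (HeadCtx × ℕ × Atom) × ℕ × Term
  have hX : Primrec fun y : ArgCtx => y.1.1 := Primrec.fst.comp Primrec.fst
  have hi : Primrec fun y : ArgCtx => y.1.2.1 := Primrec.fst.comp (Primrec.snd.comp Primrec.fst)
  have ha : Primrec fun y : ArgCtx => y.1.2.2.2 :=
    Primrec.snd.comp (Primrec.snd.comp (Primrec.snd.comp Primrec.fst))
  have hj : Primrec fun y : ArgCtx => y.2.1 := Primrec.fst.comp Primrec.snd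
  have ht : Primrec fun y : ArgCtx => y.2.2 := Primrec.snd.comp Primrec.snd
  have hV : Primrec fun y : ArgCtx =>
      conjVars (y.1.1.2.take y.1.2.1) ++ termVars (y.1.2.2.2.take y.2.1) :=
    Primrec.list_append.comp
      (primrec_conjVars.comp (Primrec.list_take.comp hi (Primrec.snd.comp hX)))
      (primrec_termVars.comp (Primrec.list_take.comp hj ha))
  have hnew : Primrec fun y : ArgCtx => copyVar y.1.1.1.1.1 y.1.1.1.1.2 y.1.2.1 y.2.1 :=
    (primrec_copyVar.comp ((Primrec.fst.comp (Primrec.fst.comp hX)).pair (hi.pair hj)) :)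
  have harg : Primrec fun y : ArgCtx => splitArg y.1.1.1.2
      (conjVars (y.1.1.2.take y.1.2.1) ++ termVars (y.1.2.2.2.take y.2.1))
      (copyVar y.1.1.1.1.1 y.1.1.1.1.2 y.1.2.1 y.2.1) y.2.2 :=
    (primrec_splitArg.comp
      (((Primrec.snd.comp (Primrec.fst.comp hX)).pair hV).pair (hnew.pair ht)) :)
  have hargs : Primrec fun z : HeadCtx × ℕ × Atom => z.2.2.2.mapIdx fun j t => splitArg z.1.1.2
      (conjVars (z.1.2.take z.2.1) ++ termVars (z.2.2.2.take j))
      (copyVar z.1.1.1.1 z.1.1.1.2 z.2.1 j) t :=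
    primrec_mapIdx (Primrec.snd.comp (Primrec.snd.comp Primrec.snd)) harg
  simp only [splitHead_eq]
  exact primrec_mapIdx Primrec.snd
    ((Primrec.fst.comp (Primrec.snd.comp Primrec.snd)).pair hargs)
theorem primrec_ruleOfSplit : Primrec fun x : ((Ontology × ℕ) × Rule) × SplitData =>
    ruleOfSplit x.1.1.1 x.1.1.2 x.1.2 x.2 := by
  let X := ((Ontology × ℕ) × Rule) × SplitData
  have hB : Primrec fun x : X => x.2.2.2 := Primrec.snd.comp (Primrec.snd.comp Primrec.snd)
  have hH : Primrec fun x : X => splitHead x.2.2.2 (copyVar x.1.1.1 x.1.1.2) x.1.2.2 :=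
    primrec_splitHead.comp (((Primrec.fst.comp Primrec.fst).pair hB).pair
      (Primrec.snd.comp (Primrec.snd.comp Primrec.fst)))
  have hR : Primrec fun x : X => ((splitHead x.2.2.2 (copyVar x.1.1.1 x.1.1.2) x.1.2.2).flatMap
      Prod.snd).filter fun p => p.1 ≠ p.2 :=
    primrec_filter (p := fun _ p => p.1 ≠ p.2)
      (Primrec.list_flatMap hH (Primrec.snd.comp Primrec.snd).to₂)
      (primrecPred_eq (Primrec.fst.comp Primrec.snd) (Primrec.snd.comp Primrec.snd)).not
  have hn : Primrec fun x : X => freshName x.1.1.1 + x.1.1.2 :=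
    Primrec.nat_add.comp (primrec_freshName.comp (Primrec.fst.comp (Primrec.fst.comp Primrec.fst)))
      (Primrec.snd.comp (Primrec.fst.comp Primrec.fst))
  have hargs : Primrec fun x : X => x.2.2.2.map Term.var ++
      (((splitHead x.2.2.2 (copyVar x.1.1.1 x.1.1.2) x.1.2.2).flatMap
        Prod.snd).filter fun p => p.1 ≠ p.2).map Prod.snd :=
    Primrec.list_append.comp (Primrec.list_map hB (Primrec.sumInr.comp Primrec.snd).to₂)
      (Primrec.list_map hR (Primrec.snd.comp Primrec.snd).to₂)
  have hhead : Primrec fun x : X => (splitHead x.2.2.2 (copyVar x.1.1.1 x.1.1.2) x.1.2.2).map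
      fun a => (a.1, a.2.map Prod.snd) :=
    Primrec.list_map (g := fun _ (a : AtomOver (Term × Term)) => (a.1, a.2.map Prod.snd)) hH
      ((Primrec.fst.comp Primrec.snd).pair (Primrec.list_map (Primrec.snd.comp Primrec.snd)
        (Primrec.snd.comp Primrec.snd).to₂)).to₂
  have hvars : Primrec fun x : X => x.2.2.2 ++
      termVars ((((splitHead x.2.2.2 (copyVar x.1.1.1 x.1.1.2) x.1.2.2).flatMap
        Prod.snd).filter fun p => p.1 ≠ p.2).map Prod.fst) :=
    Primrec.list_append.comp hB
      (primrec_termVars.comp (Primrec.list_map hR (Primrec.fst.comp Primrec.snd).to₂))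
  exact ((Primrec.list_cons.comp (hn.pair hargs) (Primrec.fst.comp Primrec.snd)).pair hhead).pair
    (hn.pair (hvars.pair (Primrec.fst.comp (Primrec.snd.comp Primrec.snd))))

/-- The main part is computable, together with the queries for its auxiliary predicates. -/
theorem computable_mainPart_auxQueries :
    Computable fun S : Ontology => (mainPart S, auxQueries S) := by
  let G : Ontology → List AffItem × List ProbItem → List (Rule × ℕ × CQ) := fun S c =>
    S.mapIdx fun k σ => ruleOfSplit S k σ (splitIn S c.1 c.2 σ)
  have hG : Primrec₂ G := by
    refine primrec_mapIdx (g := fun (x : Ontology × List AffItem × List ProbItem) k σ =>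
      ruleOfSplit x.1 k σ (splitIn x.1 x.2.1 x.2.2 σ)) Primrec.fst ?_
    have hσ : Primrec fun y : (Ontology × List AffItem × List ProbItem) × ℕ × Rule => y.2.2 :=
      Primrec.snd.comp Primrec.snd
    refine primrec_ruleOfSplit.comp ((((Primrec.fst.comp Primrec.fst).pair
      (Primrec.fst.comp Primrec.snd)).pair hσ).pair (primrec_splitIn.comp
      ((((Primrec.fst.comp Primrec.fst).pair
          (Primrec.fst.comp (Primrec.snd.comp Primrec.fst))).pair
        (Primrec.snd.comp (Primrec.snd.comp Primrec.fst))).pair hσ)))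
  have hlist : Computable fun S : Ontology => S.mapIdx fun k σ =>
      (mainRule S k σ, freshName S + k, auxQuery S k σ) := by
    -- A certificate is a list of the affected positions with a list of the problematic atoms.
    refine computable_of_certificate
      (R := fun S c => AffList S c.1 ∧ ProbList S c.1 c.2) ?_ hG.to_comp (fun S => ?_) ?_
    · refine PrimrecPred.computablePred (PrimrecPred.and (primrecPred_affList.comp
        (Primrec.fst.pair (Primrec.fst.comp Primrec.snd))) (primrecPred_probList.comp
        (f := fun x : Ontology × List AffItem × List ProbItem => ((x.1, x.2.1), x.2.2))
        ((Primrec.fst.pair (Primrec.fst.comp Primrec.snd)).pair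
          (Primrec.snd.comp Primrec.snd))))
    · obtain ⟨L, hL⟩ := exists_affList S
      obtain ⟨M, hM⟩ := exists_probList S L
      exact ⟨(L, M), hL, hM⟩
    · rintro S ⟨L, M⟩ ⟨hL, hM⟩
      refine List.ext_getElem (by simp [G]) fun i h₁ h₂ => ?_
      simp only [G, List.getElem_mapIdx]
      rw [splitIn_eq hL hM (List.getElem_mem _), ruleOfSplit_eq]
  have hproj : Primrec fun l : List (Rule × ℕ × CQ) => (l.map Prod.fst, l.map Prod.snd) :=
    (Primrec.list_map Primrec.id (Primrec.fst.comp Primrec.snd).to₂).pair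
      (Primrec.list_map Primrec.id (Primrec.snd.comp Primrec.snd).to₂)
  refine (hproj.to_comp.comp hlist).of_eq fun S => ?_
  refine Prod.ext ?_ ?_ <;> exact List.ext_getElem (by simp [mainPart, auxQueries])
    fun i h₁ h₂ => by simp [mainPart, auxQueries]

/-! ### Computability: certain answers -/

/-- Partial recursive functions are limits of primitive recursive ones, which run with fuel. -/
theorem exists_fuel {α β : Type} [Primcodable α] [Primcodable β] {f : α →. β} (hf : Partrec f) :
    ∃ F : ℕ → α → Option β, Primrec₂ F ∧ (∀ k k' a b, k ≤ k' → b ∈ F k a → b ∈ F k' a) ∧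
      ∀ a b, b ∈ f a ↔ ∃ k, b ∈ F k a := by
  obtain ⟨c, hc⟩ := Nat.Partrec.Code.exists_code.1 hf
  have hmem : ∀ a n, n ∈ c.eval (Encodable.encode a) ↔ ∃ b ∈ f a, Encodable.encode b = n := by
    intro a n
    rw [hc]
    simp
  refine ⟨fun k a => (c.evaln k (Encodable.encode a)).bind Encodable.decode, ?_, ?_, ?_⟩
  · refine Primrec.option_bind (Nat.Partrec.Code.primrec_evaln.comp
      (g := fun x : ℕ × α => ((x.1, c), Encodable.encode x.2)) ?_)
      (Primrec.decode.comp Primrec.snd).to₂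
    exact (Primrec.fst.pair (Primrec.const c)).pair (Primrec.encode.comp Primrec.snd)
  · intro k k' a b hk hb
    obtain ⟨n, hn, hb⟩ := Option.bind_eq_some_iff.1 hb
    exact Option.bind_eq_some_iff.2 ⟨n, Nat.Partrec.Code.evaln_mono hk hn, hb⟩
  · intro a b
    constructor
    · intro hb
      obtain ⟨k, hk⟩ := Nat.Partrec.Code.evaln_complete.1 ((hmem a _).2 ⟨b, hb, rfl⟩)
      exact ⟨k, Option.bind_eq_some_iff.2 ⟨_, hk, Encodable.encodek b⟩⟩
    · rintro ⟨k, hk⟩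
      obtain ⟨n, hn, hb⟩ := Option.bind_eq_some_iff.1 hk
      obtain ⟨b', hb', rfl⟩ := (hmem a n).1 (Nat.Partrec.Code.evaln_sound hn)
      rw [Encodable.encodek] at hb
      exact Option.some.inj hb ▸ hb'

theorem Derivation.mono {α : Type} {P Q : List α → α → Prop} (h : ∀ A a, P A a → Q A a)
    {A : List α} (hA : Derivation P A) : Derivation Q A := by
  induction hA with
  | nil => exact .nil
  | cons ha _ ih => exact .cons (h _ _ ha) ih

/-- What the saturation with auxiliary facts depends on: the renamed database, the constants,
the main part, and the queries for the auxiliary predicates. -/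
abbrev SatInput := (Database × List ℕ) × Ontology × List (ℕ × CQ)

noncomputable def satInput (S : Ontology) (D : Database) : SatInput :=
  ((shiftAtoms S D, domain D S), mainPart S, auxQueries S)

/-- The fact follows from the facts `A` by the function `F`. -/
def FuelStep (F : Input → Option Bool) (x : SatInput) (A : Database) (a : Fact) : Prop :=
  ∃ e ∈ x.2.2, a.1 = e.1 ∧ a.2 ∈ tuples x.1.2 e.2.1.length ∧
    F (x.1.1 ++ A, x.2.1, e.2, a.2) = some true

/-- The function `F` confirms that the list `A` of auxiliary facts is a saturated derivation. -/
def FuelSaturated (F : Input → Option Bool) (x : SatInput) (A : Database) : Prop :=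
  Derivation (FuelStep F x) A ∧ ∀ e ∈ x.2.2, ∀ t ∈ tuples x.1.2 e.2.1.length,
    (F (x.1.1 ++ A, x.2.1, e.2, t) = some true ∧ (e.1, t) ∈ A) ∨
      F (x.1.1 ++ A, x.2.1, e.2, t) = some false

section Correctness

variable {C : Set Ontology} {S : Ontology} {D : Database}

/-- All questions asked during saturation are genuine inputs for `C`, so the answers of the
algorithm can be trusted. -/
theorem isInput_auxQuery (hS : mainPart S ∈ C) {e : ℕ × CQ} (he : e ∈ auxQueries S)
    {U : List ℕ} {t : List ℕ} (ht : t ∈ tuples U e.2.1.length) (D : Database) :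
    IsInput C (D, mainPart S, e.2, t) := by
  obtain ⟨k, σ, -, -, hq⟩ := mem_auxQueries.1 he
  exact ⟨hS, hq ▸ auxQuery_wellFormed S k σ, (mem_tuples.1 ht).1⟩

/-- Answers `true` justify the derivation. Closure needs definite answers `false` for the candidates
outside `A`; running out of fuel does not count as one. -/
theorem FuelSaturated.derivation {F : Input → Option Bool}
    (hF : ∀ w, IsInput C w → ∀ b, F w = some b → (b = true ↔ Holds w)) (hS : mainPart S ∈ C)
    {A : Database} (hA : FuelSaturated F (satInput S D) A) :
    Derivation (AuxStep S D) A ∧ ∀ a, AuxStep S D A a → a ∈ A := by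
  refine ⟨hA.1.mono ?_, ?_⟩
  · rintro A a ⟨e, he, hn, ht, hFe⟩
    refine ⟨e.2, hn ▸ he, ht, ?_⟩
    exact (hF _ (isInput_auxQuery hS he ht _) _ hFe).1 rfl
  · rintro ⟨n, t⟩ ⟨q, hq, ht, hc⟩
    rcases hA.2 (n, q) hq t ht with h | h
    · exact h.2
    · exact absurd ((hF _ (isInput_auxQuery hS hq ht _) _ h).2 hc) Bool.false_ne_true

open Filter in
-- A saturated derivation exists, and its confirmation involves finitely many questions, each of
-- them answered for all large `k`. Hence some amount of fuel serves them all.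
theorem exists_fuelSaturated {F : ℕ → Input → Option Bool}
    (hF : ∀ w, IsInput C w → ∀ᶠ k in atTop, ∃ b, F k w = some b ∧ (b = true ↔ Holds w))
    (hS : mainPart S ∈ C) (D : Database) : ∃ A k, FuelSaturated (F k) (satInput S D) A := by
  obtain ⟨A, hA, hcl⟩ := exists_saturated (AuxStep S D)
    ((auxQueries S).flatMap fun e => (tuples (domain D S) e.2.1.length).map fun t => (e.1, t))
    fun A a ⟨q, hq, ht, _⟩ => List.mem_flatMap.2 ⟨_, hq, List.mem_map.2 ⟨_, ht, rfl⟩⟩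
  refine ⟨A, Eventually.exists (f := atTop) (Eventually.and ?_ ?_)⟩
  · clear hcl
    induction hA with
    | nil => exact Eventually.of_forall fun _ => .nil
    | @cons a A ha _ ih =>
      obtain ⟨q, hq, ht, hc⟩ := ha
      filter_upwards [ih, hF _ (isInput_auxQuery hS hq ht (auxDatabase S D A))]
      rintro k hA ⟨b, hb, hbc⟩
      refine .cons ⟨_, hq, rfl, ht, ?_⟩ hA
      rw [hbc.2 hc] at hb
      exact hb
  · refine (eventually_all_finite (List.finite_toSet (auxQueries S))).2 fun e he =>
      (eventually_all_finite (List.finite_toSet (tuples (domain D S) e.2.1.length))).2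
        fun t ht => ?_
    filter_upwards [hF _ (isInput_auxQuery hS he ht (auxDatabase S D A))]
    rintro k ⟨b, hb, hbc⟩
    cases b with
    | true => exact Or.inl ⟨hb, hcl _ ⟨_, he, ht, hbc.1 rfl⟩⟩
    | false => exact Or.inr hb

end Correctness

/-! ### Primitive recursive verification of saturation -/

theorem primrec_tuples : Primrec₂ tuples := by
  refine (Primrec.nat_rec' (f := fun x : List ℕ × ℕ => x.2) (g := fun _ => [[]])
    (h := fun x y => y.2.flatMap fun t => x.1.map fun u => u :: t)
    Primrec.snd (Primrec.const _) ?_).of_eq fun x => ?_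
  · refine Primrec.list_flatMap (Primrec.snd.comp Primrec.snd) ?_
    refine Primrec.list_map (Primrec.fst.comp (Primrec.fst.comp Primrec.fst)) ?_
    exact Primrec.list_cons.comp Primrec.snd (Primrec.snd.comp Primrec.fst)
  · obtain ⟨U, n⟩ := x
    induction n with
    | zero => rfl
    | succ n ih => exact congrArg (List.flatMap _) ih

theorem primrec_shiftName : Primrec₂ shiftName :=
  Primrec.ite (Primrec.nat_lt.comp Primrec.snd (primrec_freshName.comp Primrec.fst)) Primrec.snd
    (Primrec.nat_add.comp Primrec.snd (Primrec.list_length.comp Primrec.fst))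

theorem primrec_shiftAtoms {α : Type} [Primcodable α] :
    Primrec₂ (shiftAtoms : Ontology → List (AtomOver α) → List (AtomOver α)) :=
  Primrec.list_map (f := fun x : Ontology × List (AtomOver α) => x.2)
    (g := fun x a => (shiftName x.1 a.1, a.2)) Primrec.snd
    ((primrec_shiftName.comp (Primrec.fst.comp Primrec.fst)
      (Primrec.fst.comp Primrec.snd)).pair (Primrec.snd.comp Primrec.snd)).to₂

theorem primrec_domain : Primrec₂ domain := by
  refine Primrec.list_append.comp (Primrec.list_flatMap Primrec.fst
    (Primrec.snd.comp Primrec.snd).to₂) (Primrec.list_flatMap Primrec.snd ?_)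
  refine Primrec.list_flatMap (Primrec.snd.comp Primrec.snd) ?_
  exact Primrec.listFilterMap (Primrec.snd.comp Primrec.snd)
    (primrec_getLeft?.comp Primrec.snd).to₂

theorem computable_satInput : Computable fun w : Input => satInput w.2.1 w.1 := by
  have hS : Computable fun w : Input => w.2.1 := Computable.fst.comp Computable.snd
  exact ((primrec_shiftAtoms.to_comp.comp hS Computable.fst).pair
    (primrec_domain.to_comp.comp Computable.fst hS)).pair (computable_mainPart_auxQueries.comp hS)

theorem primrec_fuelQuery {F : ℕ → Input → Option Bool} (hF : Primrec₂ F) :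
    Primrec fun y : (SatInput × Database × ℕ) × (ℕ × CQ) × List ℕ =>
      F y.1.2.2 (y.1.1.1.1 ++ y.1.2.1, y.1.1.2.1, y.2.1.2, y.2.2) := by
  let Y := (SatInput × Database × ℕ) × (ℕ × CQ) × List ℕ
  have hx : Primrec fun y : Y => y.1.1 := Primrec.fst.comp Primrec.fst
  have hA : Primrec fun y : Y => y.1.2.1 := Primrec.fst.comp (Primrec.snd.comp Primrec.fst)
  have hk : Primrec fun y : Y => y.1.2.2 := Primrec.snd.comp (Primrec.snd.comp Primrec.fst)
  have hq : Primrec fun y : Y => y.2.1.2 := Primrec.snd.comp (Primrec.fst.comp Primrec.snd)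
  have ht : Primrec fun y : Y => y.2.2 := Primrec.snd.comp Primrec.snd
  exact (hF.comp hk ((Primrec.list_append.comp (Primrec.fst.comp (Primrec.fst.comp hx)) hA).pair
    ((Primrec.fst.comp (Primrec.snd.comp hx)).pair (hq.pair ht))) :)

theorem primrec_fuelTuples : Primrec fun y : (SatInput × Database × ℕ) × (ℕ × CQ) =>
    tuples y.1.1.1.2 y.2.2.1.length := by
  have hU : Primrec fun y : (SatInput × Database × ℕ) × (ℕ × CQ) => y.1.1.1.2 :=
    Primrec.snd.comp (Primrec.fst.comp (Primrec.fst.comp Primrec.fst))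
  have hq : Primrec fun y : (SatInput × Database × ℕ) × (ℕ × CQ) => y.2.2.1 :=
    Primrec.fst.comp (Primrec.snd.comp Primrec.snd)
  exact (primrec_tuples.comp hU (Primrec.list_length.comp hq) :)

theorem primrecPred_fuelStep {F : ℕ → Input → Option Bool} (hF : Primrec₂ F) :
    PrimrecPred fun y : (SatInput × Database × ℕ) × Fact =>
      FuelStep (F y.1.2.2) y.1.1 y.1.2.1 y.2 := by
  let Y := ((SatInput × Database × ℕ) × Fact) × (ℕ × CQ)
  have hx : Primrec fun y : Y => y.1.1 := Primrec.fst.comp Primrec.fst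
  have hn : Primrec fun y : Y => y.1.2.1 := Primrec.fst.comp (Primrec.snd.comp Primrec.fst)
  have ht : Primrec fun y : Y => y.1.2.2 := Primrec.snd.comp (Primrec.snd.comp Primrec.fst)
  have he : Primrec fun y : Y => y.2 := Primrec.snd
  have h₁ := primrecPred_eq hn (Primrec.fst.comp he)
  have h₂ := primrecPred_mem ht (primrec_fuelTuples.comp (hx.pair he))
  have h₃ := primrecPred_eq ((primrec_fuelQuery hF).comp (hx.pair (he.pair ht)))
    (Primrec.const (some true))
  exact primrecPred_bex (Primrec.snd.comp (Primrec.snd.comp (Primrec.fst.comp Primrec.fst)))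
    (h₁.and (h₂.and h₃))

theorem primrecPred_fuelSaturated {F : ℕ → Input → Option Bool} (hF : Primrec₂ F) :
    PrimrecPred fun x : SatInput × Database × ℕ => FuelSaturated (F x.2.2) x.1 x.2.1 := by
  refine PrimrecPred.and (primrecPred_derivation
    (P := fun x : SatInput × Database × ℕ => FuelStep (F x.2.2) x.1)
    (Primrec.fst.comp Primrec.snd) ?_) ?_
  · let Y := (SatInput × Database × ℕ) × Database × Fact
    have hx : Primrec fun y : Y => y.1.1 := Primrec.fst.comp Primrec.fst
    have hk : Primrec fun y : Y => y.1.2.2 := Primrec.snd.comp (Primrec.snd.comp Primrec.fst)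
    have hA : Primrec fun y : Y => y.2.1 := Primrec.fst.comp Primrec.snd
    have ha : Primrec fun y : Y => y.2.2 := Primrec.snd.comp Primrec.snd
    exact ((primrecPred_fuelStep hF).comp ((hx.pair (hA.pair hk)).pair ha) :)
  · refine primrecPred_ball (Primrec.snd.comp (Primrec.snd.comp Primrec.fst)) ?_
    refine primrecPred_ball primrec_fuelTuples ?_
    let Y := ((SatInput × Database × ℕ) × (ℕ × CQ)) × List ℕ
    have hx : Primrec fun y : Y => y.1.1 := Primrec.fst.comp Primrec.fst
    have hA : Primrec fun y : Y => y.1.1.2.1 := Primrec.fst.comp (Primrec.snd.comp hx)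
    have he : Primrec fun y : Y => y.1.2 := Primrec.snd.comp Primrec.fst
    have ht : Primrec fun y : Y => y.2 := Primrec.snd
    have hFq := (primrec_fuelQuery hF).comp (hx.pair (he.pair ht))
    exact ((primrecPred_eq hFq (Primrec.const (some true))).and
      (primrecPred_mem ((Primrec.fst.comp he).pair ht) hA)).or
        (primrecPred_eq hFq (Primrec.const (some false)))

/-! ### The decision procedures -/

theorem conjVars_shiftAtoms (S : Ontology) (A : Conj) : conjVars (shiftAtoms S A) = conjVars A := by
  simp [conjVars, shiftAtoms, List.flatMap_map]

/-- If cert-eval is decidable for `C`, then also for the ontologies whose main part is in `C`. -/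
theorem CertEvalDecidable.mainPart {C : Set Ontology} (h : CertEvalDecidable C) :
    CertEvalDecidable {S | mainPart S ∈ C} := by
  obtain ⟨f, hf, hfC⟩ := h
  obtain ⟨F, hF, hmono, hFf⟩ := exists_fuel hf
  have hsound : ∀ k w, IsInput C w → ∀ b, F k w = some b → (b = true ↔ Holds w) := by
    intro k w hw b hb
    obtain ⟨b', hb', hholds⟩ := hfC w hw
    rwa [Part.mem_unique ((hFf w b).2 ⟨k, hb⟩) hb']
  have hcomplete : ∀ w, IsInput C w →
      ∀ᶠ k in Filter.atTop, ∃ b, F k w = some b ∧ (b = true ↔ Holds w) := by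
    intro w hw
    obtain ⟨b, hb, hholds⟩ := hfC w hw
    obtain ⟨k₀, hk₀⟩ := (hFf w b).1 hb
    filter_upwards [Filter.eventually_ge_atTop k₀] with k hk
    exact ⟨b, hmono _ _ _ _ hk hk₀, hholds⟩
  obtain ⟨s, hs, hsR, hdom⟩ := exists_partrec_search (α := SatInput) (β := Database × ℕ)
    (R := fun x y => FuelSaturated (F y.2) x y.1) (primrecPred_fuelSaturated hF).computablePred
  -- The single question about the main part that replaces the original one, once the Aux facts are
  -- known.
  let next : Input → Database × ℕ → Input := fun w y =>
    (auxDatabase w.2.1 w.1 y.1, DyadicTGD.mainPart w.2.1,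
      (w.2.2.1.1, shiftAtoms w.2.1 w.2.2.1.2), w.2.2.2)
  have hnext : Computable₂ next := by
    have hw : Computable fun x : Input × Database × ℕ => x.1 := Computable.fst
    have hS : Computable fun x : Input × Database × ℕ => x.1.2.1 :=
      Computable.fst.comp (Computable.snd.comp hw)
    have hq : Computable fun x : Input × Database × ℕ => x.1.2.2.1 :=
      Computable.fst.comp (Computable.snd.comp (Computable.snd.comp hw))
    have hA : Computable fun x : Input × Database × ℕ => x.2.1 :=
      Computable.fst.comp Computable.snd
    exact (Computable.list_append.comp
      (primrec_shiftAtoms.to_comp.comp hS (Computable.fst.comp hw)) hA).pair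
      ((Computable.fst.comp (computable_mainPart_auxQueries.comp hS)).pair
        (((Computable.fst.comp hq).pair
          (primrec_shiftAtoms.to_comp.comp hS (Computable.snd.comp hq))).pair
          (Computable.snd.comp (Computable.snd.comp (Computable.snd.comp hw)))))
  refine ⟨fun w => (s (satInput w.2.1 w.1)).bind fun y => f (next w y),
    (hs.comp computable_satInput).bind (hf.comp hnext), ?_⟩
  rintro ⟨D, S, q, c⟩ ⟨hS, hq, hc⟩
  obtain ⟨A, k, hAk⟩ := exists_fuelSaturated hcomplete hS D
  -- Existence only shows that the search halts; the pair it returns may be another one, and is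
  -- correct by `FuelSaturated.derivation`.
  obtain ⟨⟨A, k⟩, hAk⟩ := Part.dom_iff_mem.1 (hdom (satInput S D) ⟨(A, k), hAk⟩)
  obtain ⟨hA, hcl⟩ := (hsR _ _ hAk).derivation (hsound k) hS
  have hin : IsInput C (next (D, S, q, c) (A, k)) :=
    ⟨hS, fun x hx => by rw [conjVars_shiftAtoms]; exact hq x hx, hc⟩
  obtain ⟨b, hb, hholds⟩ := hfC _ hin
  exact ⟨b, Part.mem_bind hAk hb, hholds.trans (cert_iff_cert_mainPart hA hcl)⟩

theorem CertEvalDecidable.dyadic {C : Set Ontology} (h : CertEvalDecidable C)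
    (hs : CaseEffective C) : CertEvalDecidable (Dyadic C) := by
  obtain ⟨g, hg, hgC⟩ := h.mainPart
  obtain ⟨f, hf, hfC⟩ := h
  obtain ⟨s, hs, hsC⟩ := hs
  refine ⟨fun w => (s w.2.1).bind fun b => bif b then f w else g w,
    (hs.comp (Computable.fst.comp Computable.snd)).bind (Partrec.cond Computable.snd
      (hf.comp Computable.fst) (hg.comp Computable.fst)).to₂, ?_⟩
  rintro ⟨D, S, q, c⟩ ⟨hS, hw⟩
  obtain ⟨b, hb, htrue, hfalse⟩ := hsC S hS
  cases b with
  | true =>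
    obtain ⟨b', hb', h⟩ := hfC (D, S, q, c) ⟨htrue rfl, hw⟩
    exact ⟨b', Part.mem_bind hb hb', h⟩
  | false =>
    obtain ⟨b', hb', h⟩ := hgC (D, S, q, c) ⟨hfalse rfl, hw⟩
    exact ⟨b', Part.mem_bind hb hb', h⟩

theorem primrecPred_wellFormed : PrimrecPred CQ.WellFormed :=
  primrecPred_ball Primrec.fst
    (primrecPred_mem Primrec.snd (primrec_conjVars.comp (Primrec.snd.comp Primrec.fst)))

/-- Membership in `C` is decidable, since the empty query has a certain answer. -/
theorem CertEvalDecidableSet.computablePred_mem {C : Set Ontology} (h : CertEvalDecidableSet C) :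
    ComputablePred fun S => S ∈ C := by
  have htriv : ∀ S : Ontology, (IsInput C ([], S, ([], []), []) ∧
      Holds ([], S, ([], []), [])) ↔ S ∈ C := fun S =>
    ⟨fun h => h.1.1, fun h => ⟨⟨h, by simp [CQ.WellFormed], rfl⟩,
      fun I _ => ⟨fun _ => Value.const 0, by simp [IsHom], rfl⟩⟩⟩
  obtain ⟨_, hC⟩ := h
  have hin : Computable fun S : Ontology => ((([], S, ([], []), []) : Input)) :=
    (Computable.const []).pair (Computable.id.pair (Computable.const _))
  classical
  exact ((hC.comp hin).of_eq fun S => decide_eq_decide.2 (htriv S)).computablePred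

theorem CertEvalDecidableSet.certEvalDecidable {C : Set Ontology} (h : CertEvalDecidableSet C) :
    CertEvalDecidable C := by
  obtain ⟨_, hC⟩ := h
  exact ⟨_, hC.partrec, fun w hw => ⟨_, Part.mem_some _, by simp [hw]⟩⟩

/-- Decidable membership in `C` supplies the case distinction for `CertEvalDecidable.dyadic` and, as
`mainPart` is computable, a test for being an input. -/
theorem CertEvalDecidableSet.dyadic {C : Set Ontology} (h : CertEvalDecidableSet C) :
    CertEvalDecidableSet (Dyadic C) := by
  classical
  have hmem := h.computablePred_mem.decide
  obtain ⟨f, hf, hfC⟩ := h.certEvalDecidable.dyadic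
    ⟨fun S => Part.some (decide (S ∈ C)), hmem.partrec, fun S hS =>
      ⟨_, Part.mem_some _, by simp, fun h => hS.resolve_left (by simpa using h)⟩⟩
  have hdyadic : Computable fun S : Ontology => decide (S ∈ C) || decide (mainPart S ∈ C) :=
    Primrec.or.to_comp.comp hmem (hmem.comp (Computable.fst.comp computable_mainPart_auxQueries))
  have hform : PrimrecPred fun w : Input =>
      CQ.WellFormed w.2.2.1 ∧ w.2.2.2.length = w.2.2.1.1.length := by
    have hq : Primrec fun w : Input => w.2.2.1 :=
      Primrec.fst.comp (Primrec.snd.comp Primrec.snd)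
    have hc : Primrec fun w : Input => w.2.2.2 :=
      Primrec.snd.comp (Primrec.snd.comp Primrec.snd)
    exact (primrecPred_wellFormed.comp hq).and (primrecPred_eq (Primrec.list_length.comp hc)
      (Primrec.list_length.comp (Primrec.fst.comp hq)))
  have hinput : Computable fun w : Input => decide (IsInput (Dyadic C) w) := by
    refine (Primrec.and.to_comp.comp (hdyadic.comp (Computable.fst.comp Computable.snd))
      hform.decide.to_comp).of_eq fun w => ?_
    rw [← Bool.decide_or, ← Bool.decide_and]
    exact decide_eq_decide.2 Iff.rfl
  -- The partial algorithm `f` runs only after the test for being an input has succeeded, so the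
  -- combined procedure is total.
  refine Computable.computablePred (Partrec.of_eq_tot (Partrec.cond hinput hf
    (Computable.const false).partrec) fun w => ?_)
  by_cases hw : IsInput (Dyadic C) w
  · obtain ⟨b, hb, hholds⟩ := hfC w hw
    have : decide (IsInput (Dyadic C) w ∧ Holds w) = b := by
      rw [Bool.eq_iff_iff, hholds]
      simp [hw]
    rw [this]
    simpa [hw] using hb
  · simp [hw]

end DyadicTGD

theorem mainTheorem1 (C : Set DyadicTGD.Ontology) :
    (DyadicTGD.CertEvalDecidable C →
      DyadicTGD.CertEvalDecidable {S | DyadicTGD.mainPart S ∈ C} ∧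
      (DyadicTGD.CaseEffective C → DyadicTGD.CertEvalDecidable (DyadicTGD.Dyadic C))) ∧
    (DyadicTGD.CertEvalDecidableSet C →
      DyadicTGD.CertEvalDecidableSet (DyadicTGD.Dyadic C)) :=
  ⟨fun h => ⟨h.mainPart, h.dyadic⟩, fun h => h.dyadic⟩
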